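/- For graphs $G$ and $H$, the Ramsey number $r(G,H)$ is the smallest positive integer $N$ such that every graph $F$ on $N$ vertices contains $G$ as a subgraph (not necessarily induced) or its complement $\overline{F}$ contains $H$ as a subgraph. Let $P_k$ denote the path with $k$ vertices and $\Delta(G)$ the maximum degree of $G$. Let $k$ and $n$ be integers with $k\ge 2$ and $n\ge 3424k^4$, and let $G$ be a connected simple graph with $n$ vertices and at most $\left(1+\frac{1}{144k^2}\right)n$ edges. If $\Delta(G)<n-\frac16\sqrt{\frac nk}$, then $$r(G,P_k)=n+\left\lfloor\frac k2\right\rfloor-1.$$ -/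

import Mathlib

open scoped SimpleGraph

/-- The Ramsey number `r(G, H)`: the smallest positive integer `N` such that every graph `F` on `N`
vertices contains `G` as a (not necessarily induced) subgraph, or its complement contains `H` as a
subgraph. (The infimum of the empty set would be `0`, so an equation `ramseyNumber G H = N` with
`N` positive says in particular that such integers exist and that `N` is the least one.) -/
noncomputable def ramseyNumber {V W : Type*} (G : SimpleGraph V) (H : SimpleGraph W) : ℕ :=
  sInf {N : ℕ | 0 < N ∧ ∀ F : SimpleGraph (Fin N), G ⊑ F ∨ H ⊑ Fᶜ}

section SparsePathRamsey

open scoped Classical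
open Finset

/-! Write `h = k / 2`. For the lower bound, two disjoint cliques with at most `n - 1` and `h - 1`
vertices contain no connected graph on `n` vertices, and a `k`-vertex path in the bipartite
complement needs `h` vertices on the small side.

For the upper bound, let `H` be a `P_k`-free graph on `N = n + h - 1` vertices; `G` has to be placed
edge-disjointly from `H`. Being `P_k`-free makes `H` sparse: it is `(k - 2)`-degenerate, so every
vertex set contains a large independent set and, with `D = √(kn)` rounded down, at most `2D + 1`
vertices (the set `T`) have degree above `D`. It also excludes `K_{h,h+1}`, and it forces maximum
degree at most `k - 2` once the minimum degree is at least `h`. On the other side, `G` is a small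
3-core `W` with at most `s` vertices, where `s` is twice the excess of edges over vertices, extended
by vertices having at most two earlier neighbours. So `W` goes into an independent set of `H`, the
bulk of `G` is placed greedily, and a reserved independent set `U` of `G` is placed last, where no
slack remains, by Hall's theorem.

The choice of `U` gives three cases. If one vertex `c` has `6D` leaf neighbours, these are `U`, and
`c` is sent to a suitable vertex `x` of `H`; should every vertex of `H` have degree at least `h`,
the surplus neighbours of `x` are covered by an independent set of non-neighbours of `c`, which
exists because of the bound on the maximum degree of `G` (`isContained_compl_of_many_leaves_at`). If
leaves are numerous but spread out, a failure of Hall's condition yields `K_{h,h+1}` or a vertex of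
too large degree (`isContained_compl_of_many_leaves`). If leaves are few, most vertices lie deep
inside paths of degree-two vertices; some of them absorb the high-degree vertices of `H`, and the
others form `U` (`isContained_compl_of_many_interiorVerts`). -/

/-- The neighbourhood of a vertex as a finset, with classical decidability. -/
noncomputable def nbrs {V : Type*} [Fintype V] (G : SimpleGraph V) (v : V) : Finset V :=
  univ.filter (G.Adj v)

@[simp] theorem mem_nbrs {V : Type*} [Fintype V] {G : SimpleGraph V} {v w : V} :
    w ∈ nbrs G v ↔ G.Adj v w := by
  simp [nbrs]

theorem pathGraph_isContained_of_list {Ω : Type*} {H : SimpleGraph Ω} {k : ℕ} (l : List Ω)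
    (hc : l.IsChain H.Adj) (hn : l.Nodup) (hl : k ≤ l.length) : SimpleGraph.pathGraph k ⊑ H := by
  rw [List.isChain_iff_getElem] at hc
  refine ⟨⟨⟨fun i => l[i.1]'(by omega), ?_⟩, ?_⟩⟩
  · intro a b hab
    rw [SimpleGraph.pathGraph_adj] at hab
    rcases hab with h | h
    · have := hc a.1 (by omega)
      simpa [h] using this
    · have := hc b.1 (by omega)
      simpa [h] using this.symm
  · intro a b hab
    have := (List.Nodup.getElem_inj_iff hn).1 hab
    exact Fin.ext this

/-! ### Degeneracy of path-free graphs, and bipartite obstructions -/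

section PathFree

variable {Ω : Type*} [Fintype Ω] {H : SimpleGraph Ω} {k h : ℕ}

theorem exists_list_path_of_forall_lt_card (X : Finset Ω) (hX : X.Nonempty) (d : ℕ)
    (hd : ∀ v ∈ X, d ≤ #(nbrs H v ∩ X)) :
    ∀ j, j ≤ d → ∃ v ∈ X, ∃ l : List Ω, (v :: l).IsChain H.Adj ∧ (v :: l).Nodup ∧
      l.length = j ∧ ∀ x ∈ l, x ∈ X := by
  intro j
  induction j with
  | zero =>
    intro _
    obtain ⟨v, hv⟩ := hX
    exact ⟨v, hv, [], by simp⟩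
  | succ j ih =>
    intro hj
    obtain ⟨v, hv, l, hc, hn, hl, hlX⟩ := ih (by omega)
    have : ¬ (nbrs H v ∩ X) ⊆ l.toFinset := by
      intro hs
      have h1 := card_le_card hs
      have h2 := hd v hv
      have h3 := l.toFinset_card_le
      omega
    obtain ⟨w, hw, hwl⟩ := not_subset.1 this
    simp only [mem_inter, mem_nbrs, List.mem_toFinset] at hw hwl
    refine ⟨w, hw.2, v :: l, ?_, ?_, by simp [hl], ?_⟩
    · rw [List.isChain_cons_cons]
      exact ⟨hw.1.symm, hc⟩
    · rw [List.nodup_cons]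
      refine ⟨?_, hn⟩
      simp only [List.mem_cons, not_or]
      exact ⟨hw.1.ne', hwl⟩
    · intro x hx
      rcases List.mem_cons.1 hx with rfl | hx
      · exact hv
      · exact hlX x hx

/-- If all degrees inside `X` were at least `k - 1`, a path in `X` could be prolonged greedily until
it has `k` vertices. This is the `(k - 2)`-degeneracy of `H`, behind both the edge count and the
independent sets. -/
theorem exists_card_nbrs_inter_le (hk : 2 ≤ k) (hfree : ¬ SimpleGraph.pathGraph k ⊑ H)
    (X : Finset Ω) (hX : X.Nonempty) : ∃ v ∈ X, #(nbrs H v ∩ X) ≤ k - 2 := by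
  by_contra! hcon
  obtain ⟨v, -, l, hc, hn, hl, -⟩ := exists_list_path_of_forall_lt_card (H := H) X hX (k - 1)
    (fun w hw => by have := hcon w hw; omega) (k - 1) le_rfl
  exact hfree (pathGraph_isContained_of_list (v :: l) hc hn (by simp; omega))

theorem sum_card_nbrs_inter_insert (X : Finset Ω) {v : Ω} (hv : v ∉ X) :
    ∑ w ∈ insert v X, #(nbrs H w ∩ insert v X) =
      ∑ w ∈ X, #(nbrs H w ∩ X) + 2 * #(nbrs H v ∩ X) := by
  have key : ∀ w ∈ X,
      #(nbrs H w ∩ insert v X) = #(nbrs H w ∩ X) + if H.Adj v w then 1 else 0 := by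
    intro w hw
    split_ifs with hvw
    · rw [inter_insert_of_mem (mem_nbrs.2 hvw.symm), card_insert_of_notMem (by simp [hv])]
    · rw [inter_insert_of_notMem (fun h => hvw (mem_nbrs.1 h).symm), add_zero]
  have h2 : ∑ w ∈ X, (if H.Adj v w then 1 else 0) = #(nbrs H v ∩ X) := by
    rw [← card_filter]
    congr 1
    ext w
    simp [and_comm]
  rw [sum_insert hv, sum_congr rfl key, sum_add_distrib, h2,
    inter_insert_of_notMem (by simp)]
  ring

theorem sum_card_nbrs_inter_le_of_degenerate (d : ℕ)
    (hd : ∀ X : Finset Ω, X.Nonempty → ∃ v ∈ X, #(nbrs H v ∩ X) ≤ d) (X : Finset Ω) :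
    ∑ v ∈ X, #(nbrs H v ∩ X) ≤ 2 * d * #X := by
  induction hn : #X generalizing X with
  | zero => simp [card_eq_zero.1 hn]
  | succ n ih =>
    obtain ⟨v, hv, hvd⟩ := hd X (card_pos.1 (by omega))
    have h1 := ih (X.erase v) (by rw [card_erase_of_mem hv]; omega)
    have h2 := card_le_card (inter_subset_inter_left (s := nbrs H v) (erase_subset v X))
    rw [← insert_erase hv, sum_card_nbrs_inter_insert _ (by simp)]
    nlinarith

theorem exists_independent_of_degenerate (d : ℕ)
    (hd : ∀ X : Finset Ω, X.Nonempty → ∃ v ∈ X, #(nbrs H v ∩ X) ≤ d) (X : Finset Ω) :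
    ∃ I ⊆ X, (∀ u ∈ I, ∀ v ∈ I, ¬ H.Adj u v) ∧ #X ≤ (d + 1) * #I := by
  induction hn : #X using Nat.strong_induction_on generalizing X with
  | _ n ih =>
  rcases X.eq_empty_or_nonempty with rfl | hX
  · exact ⟨∅, by simp, by simp, by simp at hn; omega⟩
  obtain ⟨v, hv, hvd⟩ := hd X hX
  have hlt : #(X \ insert v (nbrs H v)) < n := by
    rw [← hn]
    apply card_lt_card
    refine ⟨sdiff_subset, fun hs => ?_⟩
    have := hs hv
    simp at this
  obtain ⟨I, hIX, hI, hIc⟩ := ih _ hlt (X \ insert v (nbrs H v)) rfl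
  have hvI : ∀ u ∈ I, u ≠ v ∧ ¬ H.Adj v u := by
    intro u hu
    have := hIX hu
    simpa using (mem_sdiff.1 this).2
  refine ⟨insert v I, ?_, ?_, ?_⟩
  · intro u hu
    rcases mem_insert.1 hu with rfl | hu
    · exact hv
    · exact (mem_sdiff.1 (hIX hu)).1
  · intro a ha b hb
    rcases mem_insert.1 ha with ha | ha <;> rcases mem_insert.1 hb with hb | hb
    · rw [ha, hb]
      exact H.loopless.irrefl _
    · exact ha ▸ (hvI b hb).2
    · exact hb ▸ fun hab => (hvI a ha).2 hab.symm
    · exact hI a ha b hb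
  · rw [card_insert_of_notMem (fun hvI' => (hvI v hvI').1 rfl)]
    have h1 : X ⊆ (X \ insert v (nbrs H v)) ∪ insert v (nbrs H v ∩ X) := by
      intro u hu
      simp only [mem_union, mem_sdiff, mem_insert, mem_inter]
      tauto
    have h2 := card_le_card h1
    have h3 := card_union_le (X \ insert v (nbrs H v)) (insert v (nbrs H v ∩ X))
    have h4 := card_insert_le v (nbrs H v ∩ X)
    rw [hn] at h2
    nlinarith

omit [Fintype Ω] in
-- The path alternates, starting in the larger side `B`: odd positions go to `A`, even ones to `B`.
theorem pathGraph_isContained_of_complete_bipartite (hk : k ≤ 2 * h + 1) (A B : Finset Ω)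
    (hA : h ≤ #A) (hB : h + 1 ≤ #B) (hAB : ∀ a ∈ A, ∀ b ∈ B, H.Adj a b) :
    SimpleGraph.pathGraph k ⊑ H := by
  let a : Fin h → Ω := fun i => A.equivFin.symm (Fin.castLE hA i)
  let b : Fin (h + 1) → Ω := fun i => B.equivFin.symm (Fin.castLE hB i)
  have ha : Function.Injective a := Subtype.val_injective.comp
    (A.equivFin.symm.injective.comp (Fin.castLE_injective hA))
  have hb : Function.Injective b := Subtype.val_injective.comp
    (B.equivFin.symm.injective.comp (Fin.castLE_injective hB))
  have haA : ∀ i, a i ∈ A := fun i => (A.equivFin.symm (Fin.castLE hA i)).2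
  have hbB : ∀ i, b i ∈ B := fun i => (B.equivFin.symm (Fin.castLE hB i)).2
  have hadj : ∀ i j, H.Adj (a i) (b j) := fun i j => hAB _ (haA i) _ (hbB j)
  let f : Fin k → Ω := fun i =>
    if hi : i.1 % 2 = 1 then a ⟨i.1 / 2, by omega⟩ else b ⟨i.1 / 2, by omega⟩
  have hf : ∀ i j : Fin k, i.1 + 1 = j.1 → H.Adj (f i) (f j) := by
    intro i j hij
    by_cases hi : i.1 % 2 = 1
    · have hj : ¬ j.1 % 2 = 1 := by omega
      simp only [f, hi, hj, dif_pos, dif_neg, not_false_iff]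
      exact hadj _ _
    · have hj : j.1 % 2 = 1 := by omega
      simp only [f, hi, hj, dif_pos, dif_neg, not_false_iff]
      exact (hadj _ _).symm
  refine ⟨⟨⟨f, ?_⟩, ?_⟩⟩
  · intro i j hij
    rw [SimpleGraph.pathGraph_adj] at hij
    rcases hij with h' | h'
    · exact hf i j h'
    · exact (hf j i h').symm
  · intro i j (hij : f i = f j)
    by_cases hi : i.1 % 2 = 1 <;> by_cases hj : j.1 % 2 = 1 <;>
      simp only [f, hi, hj, dif_pos, dif_neg, not_false_iff] at hij
    · have := Fin.mk.inj_iff.1 (ha hij)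
      omega
    · exact absurd (hij ▸ hadj ⟨i.1 / 2, by omega⟩ ⟨j.1 / 2, by omega⟩) (H.loopless.irrefl _)
    · exact absurd (hij ▸ hadj ⟨j.1 / 2, by omega⟩ ⟨i.1 / 2, by omega⟩) (H.loopless.irrefl _)
    · have := Fin.mk.inj_iff.1 (hb hij)
      omega

end PathFree

/-! ### Minimum degree and long paths -/

section PathFree

variable {Ω : Type*} [Fintype Ω] {H : SimpleGraph Ω} {k h : ℕ}

omit [Fintype Ω] in
theorem isChain_of_cyclic_rotation (c₁ c₂ : List Ω) (hc : (c₁ ++ c₂).IsChain H.Adj)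
    (hcyc : ∀ x ∈ (c₁ ++ c₂).getLast?, ∀ y ∈ (c₁ ++ c₂).head?, H.Adj x y) :
    (c₂ ++ c₁).IsChain H.Adj := by
  rw [List.isChain_append] at hc ⊢
  refine ⟨hc.2.1, hc.1, fun x hx y hy => hcyc x ?_ y ?_⟩
  · rw [List.getLast?_append_of_ne_nil]
    · exact hx
    · rintro rfl
      simp at hx
  · rw [List.head?_append_of_ne_nil]
    · exact hy
    · rintro rfl
      simp at hy

/-- The Dirac–Pósa argument. If neither end has a neighbour off the path, crossing chords close it
into a cycle on the same vertices; an edge leaving that cycle inside the component then gives a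
longer path. -/
theorem exists_longer_path (hk : k ≤ 2 * h + 1) (hdeg : ∀ v, h ≤ #(nbrs H v)) (v : Ω)
    (l : List Ω) (hl0 : l ≠ []) (hlk : l.length < k) (hc : l.IsChain H.Adj) (hn : l.Nodup)
    (hr : ∀ x ∈ l, H.Reachable v x) (hcard : k ≤ #(univ.filter (H.Reachable v))) :
    ∃ l' : List Ω, l'.length = l.length + 1 ∧ l'.IsChain H.Adj ∧ l'.Nodup ∧
      ∀ x ∈ l', H.Reachable v x := by
  have ext : ∀ m : List Ω, m.length = l.length → m.IsChain H.Adj → m.Nodup →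
      (∀ x ∈ m, H.Reachable v x) → ∀ z, z ∉ m → (∀ y ∈ m.head?, H.Adj z y) → m ≠ [] →
      ∃ l' : List Ω, l'.length = l.length + 1 ∧ l'.IsChain H.Adj ∧ l'.Nodup ∧
      ∀ x ∈ l', H.Reachable v x := by
    intro m hm hmc hmn hmr z hz hzy hm0
    refine ⟨z :: m, by simp [hm], ?_, by simp [hz, hmn], ?_⟩
    · rw [List.isChain_cons]
      exact ⟨hzy, hmc⟩
    · intro x hx
      rcases List.mem_cons.1 hx with rfl | hx
      · obtain ⟨y, m', rfl⟩ := List.exists_cons_of_ne_nil hm0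
        exact (hmr y (by simp)).trans (hzy y (by simp)).symm.reachable
      · exact hmr x hx
  by_cases h1 : ∃ z, z ∉ l ∧ ∀ y ∈ l.head?, H.Adj z y
  · obtain ⟨z, hz, hzy⟩ := h1
    exact ext l rfl hc hn hr z hz hzy hl0
  by_cases h2 : ∃ z, z ∉ l ∧ ∀ y ∈ l.getLast?, H.Adj z y
  · obtain ⟨z, hz, hzy⟩ := h2
    refine ext l.reverse (by simp) ?_ (by simpa using hn) (by simpa using hr) z (by simpa using hz)
      (by simpa using hzy) (by simpa using hl0)
    rw [List.isChain_reverse]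
    exact hc.imp fun a b hab => hab.symm
  have hpos : 0 < l.length := List.length_pos_iff.2 hl0
  set p := l.length with hp
  have hI : h ≤ #((range (p - 1)).filter fun i => ∃ hi : i + 1 < l.length, H.Adj l[0] l[i + 1]) := by
    refine (hdeg l[0]).trans ?_
    refine (card_le_card ?_).trans (card_image_le (f := fun i => l.getD (i + 1) v))
    intro z hz
    rw [mem_nbrs] at hz
    have hzl : z ∈ l := by
      by_contra hzl
      refine h1 ⟨z, hzl, ?_⟩
      rw [List.head?_eq_getElem?, List.getElem?_eq_getElem hpos]
      simpa using hz.symm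
    obtain ⟨i, hi, rfl⟩ := List.getElem_of_mem hzl
    have hi0 : i ≠ 0 := by
      rintro rfl
      exact H.loopless.irrefl _ hz
    obtain ⟨i, rfl⟩ := Nat.exists_eq_succ_of_ne_zero hi0
    rw [mem_image]
    refine ⟨i, ?_, ?_⟩
    · rw [mem_filter, mem_range]
      exact ⟨by omega, hi, hz⟩
    · simp [List.getD_eq_getElem?_getD, hi]
  have hJ : h ≤ #((range (p - 1)).filter fun i => ∃ hi : i + 1 < l.length, H.Adj l[p - 1] l[i]) := by
    refine (hdeg l[p - 1]).trans ?_
    refine (card_le_card ?_).trans (card_image_le (f := fun i => l.getD i v))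
    intro z hz
    rw [mem_nbrs] at hz
    have hzl : z ∈ l := by
      by_contra hzl
      refine h2 ⟨z, hzl, ?_⟩
      rw [List.getLast?_eq_getElem?, List.getElem?_eq_getElem (by omega)]
      simpa using hz.symm
    obtain ⟨i, hi, rfl⟩ := List.getElem_of_mem hzl
    have hi0 : i ≠ p - 1 := by
      rintro rfl
      exact H.loopless.irrefl _ hz
    rw [mem_image]
    refine ⟨i, ?_, ?_⟩
    · rw [mem_filter, mem_range]
      exact ⟨by omega, by omega, hz⟩
    · simp [List.getD_eq_getElem?_getD, hi]
  -- Two sets of at least `h` indices among `p - 1 < 2h` must meet, which gives the crossing chords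
  -- `l[0] l[i+1]` and `l[p-1] l[i]`.
  obtain ⟨i, hi⟩ : (((range (p - 1)).filter fun i => ∃ hi : i + 1 < l.length, H.Adj l[0] l[i + 1]) ∩
      ((range (p - 1)).filter fun i => ∃ hi : i + 1 < l.length, H.Adj l[p - 1] l[i])).Nonempty := by
    by_contra hne
    rw [not_nonempty_iff_eq_empty, ← disjoint_iff_inter_eq_empty] at hne
    have := card_union_of_disjoint hne
    have h3 := card_le_card (union_subset (filter_subset
      (fun i => ∃ hi : i + 1 < l.length, H.Adj l[0] l[i + 1]) (range (p - 1))) (filter_subset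
      (fun i => ∃ hi : i + 1 < l.length, H.Adj l[p - 1] l[i]) (range (p - 1))))
    rw [card_range] at h3
    omega
  simp only [mem_inter, mem_filter, mem_range] at hi
  obtain ⟨⟨-, hip, hi0⟩, ⟨-, _, hi1⟩⟩ := hi
  have hsplit : l.take (i + 1) ++ l.drop (i + 1) = l := List.take_append_drop _ _
  have hchain := hc
  rw [← hsplit, List.isChain_append] at hchain
  set c := (l.take (i + 1)).reverse ++ l.drop (i + 1) with hcdef
  have hperm : c.Perm l := by
    conv_rhs => rw [← hsplit]
    exact (List.reverse_perm _).append_right _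
  have hcc : c.IsChain H.Adj := by
    rw [hcdef, List.isChain_append]
    refine ⟨?_, hchain.2.1, ?_⟩
    · rw [List.isChain_reverse]
      exact hchain.1.imp fun a b hab => hab.symm
    · intro x hx y hy
      simp only [List.getLast?_reverse, List.head?_take, List.head?_drop] at hx hy
      simp [List.head?_eq_getElem?, hip] at hx hy
      rw [List.getElem?_eq_getElem hpos, Option.some_inj] at hx
      rw [← hx, ← hy]
      exact hi0
  have hcyc : ∀ x ∈ c.getLast?, ∀ y ∈ c.head?, H.Adj x y := by
    intro x hx y hy
    rw [hcdef, List.getLast?_append_of_ne_nil _ (by simp; omega), List.getLast?_drop] at hx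
    rw [hcdef, List.head?_append_of_ne_nil _ (by simp; exact hl0), List.head?_reverse,
      List.getLast?_take] at hy
    rw [List.getLast?_eq_getElem?] at hx
    simp [hip, show l.length - 1 < l.length by omega, show i < l.length by omega] at hx hy
    rw [← hx, ← hy]
    exact hi1
  obtain ⟨w, hw, hwl⟩ : ∃ w, H.Reachable v w ∧ w ∉ l := by
    by_contra! hcon
    have : univ.filter (H.Reachable v) ⊆ l.toFinset := by
      intro w hw
      simpa using hcon w (by simpa using hw)
    have h3 := card_le_card this
    have h4 := l.toFinset_card_le
    omega
  obtain ⟨q⟩ := (hr l[0] (List.getElem_mem _)).symm.trans hw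
  obtain ⟨d, -, hd1, hd2⟩ := q.exists_boundary_dart {x | x ∈ l} (List.getElem_mem _) hwl
  obtain ⟨c₁, c₂, hc12⟩ := List.append_of_mem (hperm.mem_iff.2 hd1)
  rw [hc12] at hcc hcyc
  have hperm' : (d.fst :: c₂ ++ c₁).Perm l := by
    refine List.Perm.trans ?_ hperm
    rw [hc12]
    exact List.perm_append_comm
  refine ext (d.fst :: c₂ ++ c₁) hperm'.length_eq (isChain_of_cyclic_rotation _ _ hcc hcyc)
    (hperm'.nodup_iff.2 hn) (fun x hx => hr x (hperm'.mem_iff.1 hx)) d.snd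
    (fun hx => hd2 (hperm'.mem_iff.1 hx)) ?_ (by simp)
  intro y hy
  simp at hy
  rw [← hy]
  exact d.adj.symm

/-- A vertex of degree at least `k - 1` lies in a component with at least `k` vertices, where a path
can be prolonged up to `k` vertices. -/
theorem card_nbrs_le_of_forall_le_card_nbrs (hk2 : 2 ≤ k) (hk : k ≤ 2 * h + 1)
    (hfree : ¬ SimpleGraph.pathGraph k ⊑ H) (hdeg : ∀ v, h ≤ #(nbrs H v)) (v : Ω) :
    #(nbrs H v) ≤ k - 2 := by
  by_contra! hcon
  have hcard : k ≤ #(univ.filter (H.Reachable v)) := by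
    have : insert v (nbrs H v) ⊆ univ.filter (H.Reachable v) := by
      intro w hw
      rw [mem_insert, mem_nbrs] at hw
      rw [mem_filter]
      rcases hw with rfl | hw
      · exact ⟨mem_univ _, .rfl⟩
      · exact ⟨mem_univ _, hw.reachable⟩
    have h1 := card_le_card this
    rw [card_insert_of_notMem (by simp)] at h1
    omega
  have : ∀ j, j + 1 ≤ k → ∃ l : List Ω, l.length = j + 1 ∧ l.IsChain H.Adj ∧ l.Nodup ∧
      ∀ x ∈ l, H.Reachable v x := by
    intro j
    induction j with
    | zero => exact fun _ => ⟨[v], by simp⟩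
    | succ j ih =>
      intro hj
      obtain ⟨l, hl, hc, hn, hr⟩ := ih (by omega)
      obtain ⟨l', hl', h'⟩ := exists_longer_path hk hdeg v l (by rintro rfl; simp at hl) (by omega)
        hc hn hr hcard
      exact ⟨l', by omega, h'⟩
  obtain ⟨l, hl, hc, hn, -⟩ := this (k - 1) (by omega)
  exact hfree (pathGraph_isContained_of_list l hc hn (by omega))

end PathFree

/-! ### Extending partial packings: independent sets, greedy placement, Hall -/

section Packing

variable {V Ω : Type*} {G : SimpleGraph V} {H : SimpleGraph Ω}

/-- `φ` embeds the part of `G` on `A` edge-disjointly from `H`: it is injective on `A` and maps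
adjacent vertices of `A` to vertices that are not adjacent in `H`. -/
def IsPackingOn (G : SimpleGraph V) (H : SimpleGraph Ω) (A : Finset V) (φ : V → Ω) : Prop :=
  Set.InjOn φ A ∧ ∀ u ∈ A, ∀ v ∈ A, G.Adj u v → ¬ H.Adj (φ u) (φ v)

theorem IsPackingOn.isContained_compl [Fintype V] {φ : V → Ω} (hφ : IsPackingOn G H univ φ) :
    G ⊑ Hᶜ := by
  have hinj : Function.Injective φ := fun a b hab => hφ.1 (by simp) (by simp) hab
  refine ⟨⟨⟨φ, ?_⟩, hinj⟩⟩
  intro a b hab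
  rw [SimpleGraph.compl_adj]
  exact ⟨fun h => hab.ne (hinj h), hφ.2 a (mem_univ _) b (mem_univ _) hab⟩

theorem isPackingOn_empty (φ : V → Ω) : IsPackingOn G H ∅ φ := by
  simp [IsPackingOn]

theorem isPackingOn_of_independent {A : Finset V} {φ : V → Ω} (hφ : Set.InjOn φ A)
    (hA : ∀ u ∈ A, ∀ v ∈ A, ¬ G.Adj u v) : IsPackingOn G H A φ :=
  ⟨hφ, fun u hu v hv huv => absurd huv (hA u hu v hv)⟩

theorem IsPackingOn.exists_union {A W : Finset V} {φ g : V → Ω} (hφ : IsPackingOn G H A φ)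
    (hg : IsPackingOn G H W g) (hAW : Disjoint A W) (hne : ∀ a ∈ A, ∀ w ∈ W, φ a ≠ g w)
    (hadj : ∀ a ∈ A, ∀ w ∈ W, G.Adj a w → ¬ H.Adj (φ a) (g w)) :
    ∃ φ' : V → Ω, IsPackingOn G H (A ∪ W) φ' ∧ (∀ a ∈ A, φ' a = φ a) ∧ ∀ w ∈ W, φ' w = g w := by
  let φ' : V → Ω := fun v => if v ∈ W then g v else φ v
  have h1 : ∀ a ∈ A, φ' a = φ a := fun a ha => if_neg (disjoint_left.1 hAW ha)
  have h2 : ∀ w ∈ W, φ' w = g w := fun w hw => if_pos hw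
  refine ⟨φ', ⟨?_, ?_⟩, h1, h2⟩
  · intro a ha b hb hab
    rw [mem_coe, mem_union] at ha hb
    rcases ha with ha | ha <;> rcases hb with hb | hb
    · rw [h1 a ha, h1 b hb] at hab
      exact hφ.1 ha hb hab
    · rw [h1 a ha, h2 b hb] at hab
      exact absurd hab (hne a ha b hb)
    · rw [h2 a ha, h1 b hb] at hab
      exact absurd hab.symm (hne b hb a ha)
    · rw [h2 a ha, h2 b hb] at hab
      exact hg.1 ha hb hab
  · intro a ha b hb hab
    rw [mem_union] at ha hb
    rcases ha with ha | ha <;> rcases hb with hb | hb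
    · rw [h1 a ha, h1 b hb]
      exact hφ.2 a ha b hb hab
    · rw [h1 a ha, h2 b hb]
      exact hadj a ha b hb hab
    · rw [h2 a ha, h1 b hb]
      exact fun h => hadj b hb a ha hab.symm h.symm
    · rw [h2 a ha, h2 b hb]
      exact hg.2 a ha b hb hab

theorem exists_injOn_mapsTo_of_card_le (φ : V → Ω) (W : Finset V) (I : Finset Ω)
    (hWI : #W ≤ #I) : ∃ g : V → Ω, Set.InjOn g W ∧ ∀ w ∈ W, g w ∈ I := by
  obtain ⟨e⟩ := Function.Embedding.nonempty_of_card_le (α := W) (β := I) (by simpa using hWI)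
  refine ⟨fun v => if hv : v ∈ W then e ⟨v, hv⟩ else φ v, ?_, ?_⟩
  · intro a ha b hb hab
    rw [mem_coe] at ha hb
    simp only [ha, hb, dif_pos] at hab
    have := e.injective (Subtype.ext hab)
    exact congrArg Subtype.val this
  · intro w hw
    simp [hw]

/-- Images in an independent set of `H` make the edges of `G` inside `W` harmless, so no sparsity of
`G` on `W` is needed; this is how the 3-core is placed. -/
theorem IsPackingOn.exists_union_into_independent [Fintype Ω] {A W : Finset V} {φ : V → Ω} {d : ℕ}
    (hd : ∀ X : Finset Ω, X.Nonempty → ∃ v ∈ X, #(nbrs H v ∩ X) ≤ d)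
    (hφ : IsPackingOn G H A φ) (hAW : Disjoint A W) (Λ : Finset Ω)
    (hΛ : ∀ x ∈ Λ, ∀ a ∈ A, φ a ≠ x ∧ ¬ H.Adj (φ a) x) (hcard : (d + 1) * #W ≤ #Λ) :
    ∃ φ' : V → Ω, IsPackingOn G H (A ∪ W) φ' ∧ (∀ a ∈ A, φ' a = φ a) ∧ ∀ w ∈ W, φ' w ∈ Λ := by
  obtain ⟨I, hIΛ, hI, hIc⟩ := exists_independent_of_degenerate d hd Λ
  obtain ⟨g, hg, hgI⟩ := exists_injOn_mapsTo_of_card_le φ W I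
    (Nat.le_of_mul_le_mul_left (hcard.trans hIc) (by omega))
  obtain ⟨φ', h1, h2, h3⟩ := hφ.exists_union (g := g) (W := W)
    ⟨hg, fun u hu v hv _ => hI _ (hgI u hu) _ (hgI v hv)⟩ hAW
    (fun a ha w hw => (hΛ _ (hIΛ (hgI w hw)) a ha).1)
    (fun a ha w hw _ => (hΛ _ (hIΛ (hgI w hw)) a ha).2)
  exact ⟨φ', h1, h2, fun w hw => h3 w hw ▸ hIΛ (hgI w hw)⟩

/-- Greedy placement along a degeneracy order. The bound `δ w` on the degree of the image of `w` may
vary with `w`, so that a few vertices may already sit on high-degree vertices of `H`. -/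
theorem IsPackingOn.exists_greedy [Fintype V] [Fintype Ω] {A Y : Finset V} {φ : V → Ω}
    (hφ : IsPackingOn G H A φ) (hAY : A ⊆ Y) (Λ : Finset Ω) (D : ℕ) (δ : V → ℕ)
    (hδ : ∀ a ∈ A, #(nbrs H (φ a)) ≤ δ a) (hΛ : ∀ x ∈ Λ, #(nbrs H x) ≤ D)
    (hD : ∀ w, w ∉ A → D ≤ δ w)
    (hstep : ∀ X, A ⊂ X → X ⊆ Y → ∃ v ∈ X \ A,
      #(X \ A) + ∑ w ∈ nbrs G v ∩ X, δ w ≤ #(Λ \ A.image φ)) :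
    ∃ φ' : V → Ω, IsPackingOn G H Y φ' ∧ (∀ a ∈ A, φ' a = φ a) ∧ ∀ v ∈ Y \ A, φ' v ∈ Λ := by
  suffices hmain : ∀ (j : ℕ) (X : Finset V), #(X \ A) = j → A ⊆ X → X ⊆ Y → ∃ φ' : V → Ω,
      IsPackingOn G H X φ' ∧ (∀ a ∈ A, φ' a = φ a) ∧ ∀ v ∈ X \ A, φ' v ∈ Λ from
    hmain _ Y rfl hAY subset_rfl
  intro j
  induction j with
  | zero =>
    intro X hX hAX hXY
    have : X = A := subset_antisymm (sdiff_eq_empty_iff_subset.1 (card_eq_zero.1 hX)) hAX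
    subst this
    exact ⟨φ, hφ, fun _ _ => rfl, by simp⟩
  | succ j ih =>
    intro X hX hAX hXY
    have hss : A ⊂ X := by
      refine ⟨hAX, fun h => ?_⟩
      rw [sdiff_eq_empty_iff_subset.2 h] at hX
      simp at hX
    obtain ⟨v, hv, hvc⟩ := hstep X hss hXY
    -- The vertex `v` given by `hstep` is placed last among those of `X`. It must avoid the at most
    -- `j` new images and the `H`-neighbourhoods of the images of its neighbours; counting `v`
    -- itself in `#(X \ A) = j + 1` leaves one admissible place.
    obtain ⟨hvX, hvA⟩ := mem_sdiff.1 hv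
    have herase : (X.erase v) \ A = (X \ A).erase v := by
      ext w
      simp only [mem_sdiff, mem_erase]
      tauto
    have hcard' : #(X.erase v \ A) = j := by
      rw [herase, card_erase_of_mem hv]
      omega
    have hAX' : A ⊆ X.erase v := fun a ha => mem_erase.2 ⟨fun h => hvA (h ▸ ha), hAX ha⟩
    obtain ⟨φ', h1, h2, h3⟩ := ih (X.erase v) hcard' hAX' ((erase_subset _ _).trans hXY)
    have hδ' : ∀ w ∈ X.erase v, #(nbrs H (φ' w)) ≤ δ w := by
      intro w hw
      by_cases hwA : w ∈ A
      · rw [h2 w hwA]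
        exact hδ w hwA
      · exact (hΛ _ (h3 w (mem_sdiff.2 ⟨hw, hwA⟩))).trans (hD w hwA)
    have hnb : ∀ w ∈ nbrs G v ∩ X, w ∈ X.erase v := by
      intro w hw
      rw [mem_inter, mem_nbrs] at hw
      exact mem_erase.2 ⟨hw.1.ne', hw.2⟩
    obtain ⟨x, hx, hx'⟩ : ∃ x ∈ Λ \ A.image φ, x ∉ (X.erase v \ A).image φ' ∪
        (nbrs G v ∩ X).biUnion fun w => nbrs H (φ' w) := by
      by_contra! hcon
      have h4 := card_le_card (show Λ \ A.image φ ⊆ _ from hcon)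
      have h5 := card_union_le ((X.erase v \ A).image φ')
        ((nbrs G v ∩ X).biUnion fun w => nbrs H (φ' w))
      have h6 : #((X.erase v \ A).image φ') ≤ j := card_image_le.trans hcard'.le
      have h7 : #((nbrs G v ∩ X).biUnion fun w => nbrs H (φ' w)) ≤ ∑ w ∈ nbrs G v ∩ X, δ w :=
        card_biUnion_le.trans (sum_le_sum fun w hw => hδ' w (hnb w hw))
      omega
    simp only [mem_union, mem_image, mem_biUnion, not_or, not_exists, not_and, mem_sdiff] at hx hx'
    have hxne : ∀ a ∈ X.erase v, φ' a ≠ x := by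
      intro a ha hax
      by_cases haA : a ∈ A
      · exact hx.2 a haA (by rw [← h2 a haA, hax])
      · exact hx'.1 a ⟨ha, haA⟩ hax
    obtain ⟨φ'', g1, g2, g3⟩ := h1.exists_union (W := {v}) (g := fun _ => x)
      ⟨by simp, by simp⟩ (by simp) (by
        intro a ha w _
        exact hxne a ha) (by
        intro a ha w hw haw hadj
        rw [mem_singleton] at hw
        subst hw
        exact hx'.2 a (mem_inter.2 ⟨mem_nbrs.2 haw.symm, (mem_erase.1 ha).2⟩) (mem_nbrs.2 hadj))
    refine ⟨φ'', ?_, fun a ha => (g2 a (hAX' ha)).trans (h2 a ha), ?_⟩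
    · rwa [union_comm, ← insert_eq, insert_erase hvX] at g1
    · intro w hw
      rw [mem_sdiff] at hw
      by_cases hwv : w = v
      · subst hwv
        rw [g3 w (by simp)]
        exact hx.1
      · rw [g2 w (mem_erase.2 ⟨hwv, hw.1⟩)]
        exact h3 w (mem_sdiff.2 ⟨mem_erase.2 ⟨hwv, hw.1⟩, hw.2⟩)

theorem IsPackingOn.exists_union_of_hall {Y U : Finset V} {φ : V → Ω}
    (hφ : IsPackingOn G H Y φ) (hYU : Disjoint Y U) (hU : ∀ u ∈ U, ∀ v ∈ U, ¬ G.Adj u v)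
    (t : V → Finset Ω)
    (ht : ∀ u ∈ U, ∀ x ∈ t u, ∀ a ∈ Y, φ a ≠ x ∧ (G.Adj a u → ¬ H.Adj (φ a) x))
    (hall : ∀ S ⊆ U, #S ≤ #(S.biUnion t)) :
    ∃ φ' : V → Ω, IsPackingOn G H (Y ∪ U) φ' := by
  obtain ⟨f, hf, hft⟩ := (Finset.all_card_le_biUnion_card_iff_exists_injective
    (fun u : U => t u)).1 (by
      intro S
      have := hall (S.map (Function.Embedding.subtype _)) (by
        intro u hu
        simp only [mem_map, Function.Embedding.coe_subtype] at hu
        obtain ⟨a, -, rfl⟩ := hu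
        exact a.2)
      rw [card_map] at this
      refine this.trans (card_le_card ?_)
      intro x hx
      simp only [mem_biUnion, mem_map, Function.Embedding.coe_subtype] at hx ⊢
      obtain ⟨_, ⟨a, ha, rfl⟩, hx⟩ := hx
      exact ⟨a, ha, hx⟩)
  let g : V → Ω := fun v => if hv : v ∈ U then f ⟨v, hv⟩ else φ v
  have hg : ∀ u (hu : u ∈ U), g u = f ⟨u, hu⟩ := fun u hu => dif_pos hu
  have hgt : ∀ u ∈ U, g u ∈ t u := fun u hu => hg u hu ▸ hft ⟨u, hu⟩
  obtain ⟨φ', h1, -, -⟩ := hφ.exists_union (W := U) (g := g) (isPackingOn_of_independent (by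
      intro a ha b hb hab
      rw [mem_coe] at ha hb
      rw [hg a ha, hg b hb] at hab
      exact congrArg Subtype.val (hf hab)) hU) hYU
    (fun a ha w hw => (ht w hw _ (hgt w hw) a ha).1)
    (fun a ha w hw haw => (ht w hw _ (hgt w hw) a ha).2 haw)
  exact ⟨φ', h1⟩

end Packing

/-! ### Structure of a connected graph with few excess edges -/

section SparseStructure

variable {V : Type*} [Fintype V] {G : SimpleGraph V}

/-- Take `W` of maximum size: a larger `X` violating the second property would itself satisfy the
first. -/
theorem exists_three_core (G : SimpleGraph V) : ∃ W : Finset V, (∀ v ∈ W, 3 ≤ #(nbrs G v ∩ W)) ∧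
    ∀ X, W ⊂ X → ∃ v ∈ X \ W, #(nbrs G v ∩ X) ≤ 2 := by
  obtain ⟨W, hW, hmax⟩ := exists_max_image
    (univ.filter fun W : Finset V => ∀ v ∈ W, 3 ≤ #(nbrs G v ∩ W)) card ⟨∅, by simp⟩
  rw [mem_filter] at hW
  refine ⟨W, hW.2, fun X hX => ?_⟩
  by_contra! hcon
  refine (card_lt_card hX).not_ge (hmax X ?_)
  rw [mem_filter]
  refine ⟨mem_univ _, fun v hv => ?_⟩
  by_cases hvW : v ∈ W
  · exact (hW.2 v hvW).trans (card_le_card (inter_subset_inter_left hX.1))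
  · exact hcon v (mem_sdiff.2 ⟨hv, hvW⟩)

/-- By connectivity, `W` can be enlarged one vertex at a time, each new vertex bringing at least one
edge. Hence no vertex subset has more excess than `G` allows. -/
theorem sum_card_nbrs_inter_add_le (hG : G.Connected) (W : Finset V) (hW : W.Nonempty) :
    ∑ v ∈ W, #(nbrs G v ∩ W) + 2 * #Wᶜ ≤ ∑ v, #(nbrs G v) := by
  induction hn : #Wᶜ generalizing W with
  | zero =>
    have : W = univ := by
      rw [← compl_eq_empty_iff, ← card_eq_zero, hn]
    subst this
    simp
  | succ n ih =>
    obtain ⟨w, hw⟩ := hW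
    obtain ⟨u, hu⟩ := card_pos.1 (show 0 < #Wᶜ by omega)
    obtain ⟨p⟩ := hG.preconnected w u
    obtain ⟨d, -, hd1, hd2⟩ := p.exists_boundary_dart (W : Set V) hw (by simpa using hu)
    rw [mem_coe] at hd1 hd2
    have h1 := ih (insert d.snd W) (insert_nonempty _ _) (by
      rw [compl_insert, card_erase_of_mem (by simpa using hd2)]
      omega)
    rw [sum_card_nbrs_inter_insert _ hd2] at h1
    have h2 : 0 < #(nbrs G d.snd ∩ W) :=
      card_pos.2 ⟨d.fst, mem_inter.2 ⟨mem_nbrs.2 d.adj.symm, hd1⟩⟩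
    omega

theorem sum_card_nbrs_inter_le_two_mul_add (hG : G.Connected) {s : ℕ}
    (hs : ∑ v, #(nbrs G v) ≤ 2 * Fintype.card V + s) (W : Finset V) :
    ∑ v ∈ W, #(nbrs G v ∩ W) ≤ 2 * #W + s := by
  rcases W.eq_empty_or_nonempty with rfl | hW
  · simp
  have h1 := sum_card_nbrs_inter_add_le hG W hW
  have h2 := card_add_card_compl W
  omega

theorem card_three_core_le (hG : G.Connected) {s : ℕ}
    (hs : ∑ v, #(nbrs G v) ≤ 2 * Fintype.card V + s) (W : Finset V)
    (hW : ∀ v ∈ W, 3 ≤ #(nbrs G v ∩ W)) : #W ≤ s := by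
  have h1 := sum_card_nbrs_inter_le_two_mul_add hG hs W
  have h2 := card_nsmul_le_sum W _ 3 hW
  simp only [smul_eq_mul] at h2
  omega

theorem nbrs_nonempty_of_connected (hG : G.Connected) (hn : 2 ≤ Fintype.card V) (v : V) :
    (nbrs G v).Nonempty := by
  have : Nontrivial V := Fintype.one_lt_card_iff_nontrivial.1 hn
  obtain ⟨w, hw⟩ := hG.preconnected.exists_adj_of_nontrivial v
  exact ⟨w, mem_nbrs.2 hw⟩

/-- The vertices such that all vertices at distance at most two have degree two. -/
noncomputable def interiorVerts (G : SimpleGraph V) : Finset V :=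
  univ.filter fun u => #(nbrs G u) = 2 ∧ ∀ a, G.Adj u a →
    #(nbrs G a) = 2 ∧ ∀ b, G.Adj a b → #(nbrs G b) = 2

theorem mem_interiorVerts {u : V} : u ∈ interiorVerts G ↔ #(nbrs G u) = 2 ∧ ∀ a, G.Adj u a →
    #(nbrs G a) = 2 ∧ ∀ b, G.Adj a b → #(nbrs G b) = 2 := by
  simp [interiorVerts]

/-- A vertex that is not interior has degree other than two, or is within distance two of such a
vertex. Exploring these neighbourhoods costs at most four times the degree sum over `X`, which the
excess and the number of leaves control. -/
theorem card_le_card_interiorVerts_add (hG : G.Connected) (hn : 2 ≤ Fintype.card V) {s : ℕ}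
    (hs : ∑ v, #(nbrs G v) ≤ 2 * Fintype.card V + s) :
    Fintype.card V ≤ #(interiorVerts G) +
      4 * (3 * s + 4 * #(univ.filter fun v => #(nbrs G v) = 1)) := by
  have hpos : ∀ v, 0 < #(nbrs G v) := fun v => card_pos.2 (nbrs_nonempty_of_connected hG hn v)
  set X := univ.filter fun v => #(nbrs G v) ≠ 2 with hX
  set L := #(univ.filter fun v => #(nbrs G v) = 1) with hL
  have hσ : ∑ v ∈ X, #(nbrs G v) ≤ 3 * s + 4 * L := by
    -- The coefficients make this an equality at degrees 1, 2 and 3.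
    have h1 : ∀ v : V, (if #(nbrs G v) ≠ 2 then #(nbrs G v) else 0) + 6 ≤
        3 * #(nbrs G v) + 4 * (if #(nbrs G v) = 1 then 1 else 0) := by
      intro v
      have := hpos v
      split_ifs <;> omega
    have h2 := sum_le_sum fun v (_ : v ∈ univ) => h1 v
    rw [sum_add_distrib, sum_add_distrib, ← mul_sum, ← mul_sum, ← card_filter, ← sum_filter] at h2
    simp only [sum_const, card_univ, smul_eq_mul] at h2
    rw [← hX, ← hL] at h2
    omega
  set Y := X.biUnion (nbrs G) with hY
  have hXc : #X ≤ ∑ v ∈ X, #(nbrs G v) := by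
    rw [card_eq_sum_ones]
    exact sum_le_sum fun v _ => hpos v
  have hYc : #Y ≤ ∑ v ∈ X, #(nbrs G v) := card_biUnion_le
  have hZc : #((Y \ X).biUnion (nbrs G)) ≤ 2 * #Y := by
    refine card_biUnion_le.trans ?_
    calc ∑ v ∈ Y \ X, #(nbrs G v) = ∑ v ∈ Y \ X, 2 := sum_congr rfl fun v hv => by
          have := (mem_sdiff.1 hv).2
          simpa [hX] using this
      _ = 2 * #(Y \ X) := by simp [mul_comm]
      _ ≤ 2 * #Y := Nat.mul_le_mul_left _ (card_le_card sdiff_subset)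
  have hcov : univ ⊆ interiorVerts G ∪ (X ∪ (Y ∪ (Y \ X).biUnion (nbrs G))) := by
    intro u _
    by_contra hcon
    simp only [mem_union, not_or] at hcon
    obtain ⟨h1, h2, h3, h4⟩ := hcon
    refine h1 (mem_interiorVerts.2 ⟨by simpa [hX] using h2, fun a ha => ?_⟩)
    have haX : #(nbrs G a) = 2 := by
      by_contra haX
      exact h3 (mem_biUnion.2 ⟨a, by simp [hX, haX], mem_nbrs.2 ha.symm⟩)
    refine ⟨haX, fun b hb => ?_⟩
    by_contra hbX
    refine h4 (mem_biUnion.2 ⟨a, mem_sdiff.2 ⟨mem_biUnion.2 ⟨b, by simp [hX, hbX],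
      mem_nbrs.2 hb.symm⟩, by simp [hX, haX]⟩, mem_nbrs.2 ha.symm⟩)
  have h5 := card_le_card hcov
  have h6 := card_union_le (interiorVerts G) (X ∪ (Y ∪ (Y \ X).biUnion (nbrs G)))
  have h7 := card_union_le X (Y ∪ (Y \ X).biUnion (nbrs G))
  have h8 := card_union_le Y ((Y \ X).biUnion (nbrs G))
  rw [card_univ] at h5
  omega

/-- In the conflict graph `K` an interior vertex meets at most 2 vertices at distance one and 4 more
through its two neighbours, so a greedy independent set keeps one vertex in seven. -/
theorem exists_separated_interiorVerts (G : SimpleGraph V) : ∃ U ⊆ interiorVerts G,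
    (∀ u ∈ U, ∀ v ∈ U, u ≠ v → Disjoint (insert u (nbrs G u)) (insert v (nbrs G v))) ∧
    #(interiorVerts G) ≤ 7 * #U := by
  let K : SimpleGraph V :=
    { Adj := fun u v => u ≠ v ∧ u ∈ interiorVerts G ∧ v ∈ interiorVerts G ∧
        ¬ Disjoint (insert u (nbrs G u)) (insert v (nbrs G v))
      symm := ⟨fun u v h => ⟨h.1.symm, h.2.2.1, h.2.1, fun h' => h.2.2.2 h'.symm⟩⟩
      loopless := ⟨fun u h => h.1 rfl⟩ }
  have hK : ∀ v, #(nbrs K v) ≤ 6 := by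
    intro v
    by_cases hv : v ∈ interiorVerts G
    · have hv' := mem_interiorVerts.1 hv
      have h1 : nbrs K v ⊆ nbrs G v ∪ (nbrs G v).biUnion (nbrs G) := by
        intro w hw
        rw [mem_nbrs] at hw
        obtain ⟨hne, -, -, hnd⟩ := hw
        obtain ⟨x, hx1, hx2⟩ := not_disjoint_iff.1 hnd
        rw [mem_insert, mem_nbrs] at hx1 hx2
        rw [mem_union, mem_biUnion, mem_nbrs]
        rcases hx1 with rfl | hx1 <;> rcases hx2 with rfl | hx2
        · exact absurd rfl hne
        · exact Or.inl hx2.symm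
        · exact Or.inl hx1
        · exact Or.inr ⟨x, mem_nbrs.2 hx1, mem_nbrs.2 hx2.symm⟩
      have h2 : #((nbrs G v).biUnion (nbrs G)) ≤ #(nbrs G v) * 2 :=
        card_biUnion_le_card_mul _ _ _ fun a ha => (hv'.2 a (mem_nbrs.1 ha)).1.le
      have h3 := card_le_card h1
      have h4 := card_union_le (nbrs G v) ((nbrs G v).biUnion (nbrs G))
      omega
    · have : nbrs K v = ∅ := by
        ext w
        simp only [mem_nbrs, notMem_empty, iff_false]
        exact fun h => hv h.2.1
      simp [this]
  obtain ⟨U, hU, hUi, hUc⟩ := exists_independent_of_degenerate (H := K) 6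
    (fun X ⟨v, hv⟩ => ⟨v, hv, (card_le_card inter_subset_left).trans (hK v)⟩) (interiorVerts G)
  refine ⟨U, hU, fun u hu v hv huv => ?_, hUc⟩
  by_contra hnd
  exact hUi u hu v hv ⟨huv, hU hu, hU hv, hnd⟩

/-- Turán's bound in terms of average degree, proved by repeatedly taking a vertex of minimum degree
and deleting its closed neighbourhood. -/
theorem exists_independent_card_sq_le (G : SimpleGraph V) (X : Finset V) :
    ∃ I ⊆ X, (∀ u ∈ I, ∀ v ∈ I, ¬ G.Adj u v) ∧
      #X ^ 2 ≤ (#X + ∑ v ∈ X, #(nbrs G v ∩ X)) * #I := by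
  induction hn : #X using Nat.strong_induction_on generalizing X with
  | _ n ih =>
  rcases X.eq_empty_or_nonempty with rfl | hX
  · exact ⟨∅, by simp, by simp, by simp at hn; simp [← hn]⟩
  obtain ⟨v, hv, hmin⟩ := exists_min_image X (fun v => #(nbrs G v ∩ X)) hX
  set B := insert v (nbrs G v ∩ X) with hB
  have hBX : B ⊆ X := insert_subset hv inter_subset_right
  have hBc : #B = #(nbrs G v ∩ X) + 1 := card_insert_of_notMem (by simp)
  have hsd := card_sdiff_add_card_eq_card hBX
  obtain ⟨I, hIX, hI, hIc⟩ := ih #(X \ B) (by omega) (X \ B) rfl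
  have hvI : ∀ u ∈ I, u ≠ v ∧ ¬ G.Adj v u := by
    intro u hu
    have h1 := mem_sdiff.1 (hIX hu)
    simp only [hB, mem_insert, mem_inter, mem_nbrs, not_or, not_and] at h1
    exact ⟨h1.2.1, fun h => h1.2.2 h h1.1⟩
  refine ⟨insert v I, ?_, ?_, ?_⟩
  · exact insert_subset hv (hIX.trans sdiff_subset)
  · intro a ha b hb
    rcases mem_insert.1 ha with ha | ha <;> rcases mem_insert.1 hb with hb | hb
    · rw [ha, hb]
      exact G.loopless.irrefl _
    · exact ha ▸ (hvI b hb).2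
    · exact hb ▸ fun hab => (hvI a ha).2 hab.symm
    · exact hI a ha b hb
  · rw [card_insert_of_notMem (fun hvI' => (hvI v hvI').1 rfl)]
    have h1 : ∑ w ∈ X \ B, #(nbrs G w ∩ (X \ B)) ≤ ∑ w ∈ X \ B, #(nbrs G w ∩ X) :=
      sum_le_sum fun w _ => card_le_card (inter_subset_inter_left sdiff_subset)
    have h2 : #B * #(nbrs G v ∩ X) ≤ ∑ w ∈ B, #(nbrs G w ∩ X) := by
      have := card_nsmul_le_sum B (fun w => #(nbrs G w ∩ X)) #(nbrs G v ∩ X)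
        fun w hw => hmin w (hBX hw)
      simpa using this
    have h3 := sum_sdiff hBX (f := fun w => #(nbrs G w ∩ X))
    set y := #(X \ B)
    set i := #I
    set f' := ∑ w ∈ X \ B, #(nbrs G w ∩ (X \ B))
    set f := ∑ w ∈ X, #(nbrs G w ∩ X)
    set t := #B
    have hd : #(nbrs G v ∩ X) = t - 1 := by omega
    have ht : 1 ≤ t := by omega
    obtain ⟨t', ht'⟩ := Nat.exists_eq_add_of_le ht
    rw [hd] at h2
    have hn' : n = y + t := by omega
    -- The `t` deleted vertices each have degree at least `t - 1`, by minimality.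
    have hS : y + f' + t ^ 2 ≤ n + f := by
      have : t * (t - 1) + t = t ^ 2 := by
        rw [ht']
        simp
        ring
      omega
    rcases Nat.eq_zero_or_pos i with hi | hi
    · rw [hi, mul_zero] at hIc
      have hy : y = 0 := by
        rcases Nat.eq_zero_or_pos y with h | h
        · exact h
        · have := pow_pos h 2
          omega
      rw [hi, hn', hy]
      nlinarith
    · refine Nat.le_of_mul_le_mul_left ?_ hi
      rw [hn']
      rw [hn'] at hS
      have h4 := Nat.mul_le_mul_right (i + 1) hIc
      have h5 := Nat.mul_le_mul_right (i * (i + 1)) hS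
      -- The Cauchy–Schwarz inequality `(y + t)² / (i + 1) ≤ y² / i + t²`, cleared of denominators.
      have h6 : i * (y + t) ^ 2 ≤ y ^ 2 * (i + 1) + t ^ 2 * (i * (i + 1)) := by
        zify
        linarith [sq_nonneg ((i : ℤ) * t - y)]
      calc i * (y + t) ^ 2 ≤ y ^ 2 * (i + 1) + t ^ 2 * (i * (i + 1)) := h6
        _ ≤ (y + f') * i * (i + 1) + t ^ 2 * (i * (i + 1)) := Nat.add_le_add_right h4 _
        _ = (y + f' + t ^ 2) * (i * (i + 1)) := by ring
        _ ≤ (y + t + f) * (i * (i + 1)) := h5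
        _ = i * ((y + t + f) * (i + 1)) := by ring

/-- The hypothesis `hc` is the maximum-degree condition squared. It gives `c` so many
non-neighbours, at least `13k` of them and more than `√(2ks) - 1`, that Turán's bound yields the
required independent set. -/
theorem exists_independent_nonneighbours (hG : G.Connected) {s k q : ℕ}
    (hs : ∑ v, #(nbrs G v) ≤ 2 * Fintype.card V + s) (hsk : 72 * k ^ 2 * s ≤ Fintype.card V)
    (hk : 2 ≤ k) (hnk : 3424 * k ^ 4 ≤ Fintype.card V) (hq : 2 * q + 1 ≤ k) (c : V)
    (hc : Fintype.card V < 36 * k * (Fintype.card V - #(nbrs G c)) ^ 2) :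
    ∃ Q : Finset V, #Q = q ∧ (∀ u ∈ Q, ∀ v ∈ Q, ¬ G.Adj u v) ∧ ∀ u ∈ Q, u ≠ c ∧ ¬ G.Adj c u := by
  set X := (insert c (nbrs G c))ᶜ with hX
  obtain ⟨I, hIX, hI, hIc⟩ := exists_independent_card_sq_le G X
  have h1 := sum_card_nbrs_inter_le_two_mul_add hG hs X
  have hXc := card_add_card_compl (insert c (nbrs G c))
  rw [card_insert_of_notMem (by simp), ← hX] at hXc
  have hq' : q ≤ #I := by
    by_contra! hcon
    set n := Fintype.card V
    set w := #X
    have hw : n - #(nbrs G c) = w + 1 := by omega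
    rw [hw] at hc
    have h2 : w ^ 2 ≤ (3 * w + s) * #I := hIc.trans (Nat.mul_le_mul_right _ (by omega))
    have h3 : 2 * w ^ 2 ≤ (3 * w + s) * k := by nlinarith
    have h4 : 2 * k * s < (w + 1) ^ 2 := by
      have : 36 * k * (2 * k * s) < 36 * k * (w + 1) ^ 2 := by nlinarith
      exact Nat.lt_of_mul_lt_mul_left this
    have h5 : 3424 * k ^ 3 < 36 * (w + 1) ^ 2 := by
      have : k * (3424 * k ^ 3) < k * (36 * (w + 1) ^ 2) := by nlinarith
      exact Nat.lt_of_mul_lt_mul_left this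
    have h6 : 13 * k ≤ w := by
      by_contra! h
      have h7 : w + 1 ≤ 13 * k := h
      have h8 := Nat.pow_le_pow_left h7 2
      nlinarith [Nat.mul_le_mul_left (k ^ 2) hk]
    nlinarith
  obtain ⟨Q, hQI, hQ⟩ := exists_subset_card_eq hq'
  refine ⟨Q, hQ, fun u hu v hv => hI u (hQI hu) v (hQI hv), fun u hu => ?_⟩
  have := hIX (hQI hu)
  simpa [hX] using this

end SparseStructure

/-! ### Graphs with many leaves -/

section LeafCases

variable {V Ω : Type*} [Fintype V] [Fintype Ω] {G : SimpleGraph V} {H : SimpleGraph Ω}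

/-- Vertices placed in advance outside the core may disturb the degeneracy order, but raise the
number of earlier neighbours by at most their number. -/
theorem exists_card_nbrs_inter_le_of_three_core {W A Y X : Finset V}
    (hW : ∀ X, W ⊂ X → ∃ v ∈ X \ W, #(nbrs G v ∩ X) ≤ 2) (hAX : A ⊂ X) (hWA : W ⊆ A)
    (hY : A \ W ⊆ Y) : ∃ v ∈ X \ A, #(nbrs G v ∩ X) ≤ 2 + #Y := by
  obtain ⟨v, hv, hvc⟩ := hW (X \ (A \ W)) (by
    obtain ⟨x, hx, hxA⟩ := exists_of_ssubset hAX
    refine ⟨fun w hw => mem_sdiff.2 ⟨hAX.1 (hWA hw), fun h => (mem_sdiff.1 h).2 hw⟩, fun hs => ?_⟩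
    exact hxA (hWA (hs (mem_sdiff.2 ⟨hx, fun h => hxA (mem_sdiff.1 h).1⟩))))
  simp only [mem_sdiff, not_and, not_not] at hv
  refine ⟨v, mem_sdiff.2 ⟨hv.1.1, fun hvA => hv.2 (hv.1.2 hvA)⟩, ?_⟩
  have h1 : nbrs G v ∩ X ⊆ (nbrs G v ∩ (X \ (A \ W))) ∪ Y := by
    intro w hw
    rw [mem_inter] at hw
    by_cases hwA : w ∈ A \ W
    · exact mem_union_right _ (hY hwA)
    · exact mem_union_left _ (mem_inter.2 ⟨hw.1, mem_sdiff.2 ⟨hw.2, hwA⟩⟩)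
  have h2 := card_le_card h1
  have h3 := card_union_le (nbrs G v ∩ (X \ (A \ W))) Y
  omega

/-- The leaves at `c` must avoid only the neighbours of `x`, the image of `c`. With `Q` occupying
`Y`, at most `h - 1` of these neighbours are still free, exactly the surplus of `N` over `n`. -/
theorem isContained_compl_of_many_leaves_at {d D h : ℕ} {W Q U : Finset V} {T Y : Finset Ω}
    {c : V} {x : Ω} (hd : ∀ X : Finset Ω, X.Nonempty → ∃ v ∈ X, #(nbrs H v ∩ X) ≤ d)
    (hN : Fintype.card Ω + 1 = Fintype.card V + h)
    (hT : ∀ z, z ∉ T → #(nbrs H z) ≤ D)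
    (hW3 : ∀ v ∈ W, 3 ≤ #(nbrs G v ∩ W))
    (hW : ∀ X, W ⊂ X → ∃ v ∈ X \ W, #(nbrs G v ∩ X) ≤ 2)
    (hU : ∀ u ∈ U, nbrs G u = {c})
    (hQ : ∀ u ∈ Q, ∀ v ∈ Q, ¬ G.Adj u v) (hQc : ∀ u ∈ Q, u ≠ c ∧ ¬ G.Adj c u)
    (hxT : x ∉ T) (hYT : ∀ z ∈ Y, z ∉ T) (hYx : Y ⊆ nbrs H x) (hYQ : #Y = #Q)
    (hxY : #(nbrs H x \ Y) + 1 ≤ h) (hcore : (d + 1) * #W + #T + (1 + #Q) * (D + 1) ≤ Fintype.card Ω)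
    (hUc : #T + (3 + #Q) * D ≤ #U) : G ⊑ Hᶜ := by
  have hcU : c ∉ U := fun h => by
    have : c ∈ nbrs G c := hU c h ▸ mem_singleton_self c
    simp at this
  have hUadj : ∀ u ∈ U, ∀ a, G.Adj a u → a = c := by
    intro u hu a hau
    have : a ∈ nbrs G u := mem_nbrs.2 hau.symm
    simpa [hU u hu] using this
  have hQU : ∀ u ∈ Q, u ∉ U := fun u hu huU => by
    have : c ∈ nbrs G u := hU u huU ▸ mem_singleton_self c
    exact (hQc u hu).2 (mem_nbrs.1 this).symm
  have hWU : ∀ u ∈ W, u ∉ U := fun u hu huU => by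
    have h1 := hW3 u hu
    have h2 := card_le_card (inter_subset_left (s₁ := nbrs G u) (s₂ := W))
    rw [hU u huU, card_singleton] at h2
    rw [hU u huU] at h1
    omega
  obtain ⟨g, hg, hgY⟩ := exists_injOn_mapsTo_of_card_le (fun _ : V => x) Q Y hYQ.ge
  have hgim : Q.image g = Y := eq_of_subset_of_card_le (image_subset_iff.2 hgY)
    (by rw [card_image_of_injOn hg, hYQ])
  obtain ⟨φ₀, h0, h0c, h0Q⟩ := (isPackingOn_of_independent (G := G) (H := H) (A := {c})
      (φ := fun _ => x) (by simp) (by simp)).exists_union (W := Q) (g := g)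
    (isPackingOn_of_independent hg hQ)
    (by simpa using fun h => (hQc c h).1 rfl)
    (fun _ _ w hw h => by
      have := hYx (hgY w hw)
      rw [← h] at this
      simp at this)
    (fun a ha w hw haw => by
      rw [mem_singleton] at ha
      exact absurd (ha ▸ haw) (hQc w hw).2)
  set A₀ : Finset V := {c} ∪ Q with hA₀
  have hA₀c : #A₀ ≤ 1 + #Q := (card_union_le _ _).trans (by simp)
  have h0T : ∀ a ∈ A₀, φ₀ a ∉ T := by
    intro a ha
    rcases mem_union.1 ha with ha' | ha'
    · rw [h0c a ha']
      exact hxT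
    · rw [h0Q a ha']
      exact hYT _ (hgY a ha')
  set E := A₀.biUnion fun a => insert (φ₀ a) (nbrs H (φ₀ a)) with hE
  have hEc : #E ≤ (1 + #Q) * (D + 1) := by
    refine (card_biUnion_le_card_mul _ _ (D + 1) fun a ha => ?_).trans
      (Nat.mul_le_mul_right _ hA₀c)
    exact (card_insert_le _ _).trans (Nat.add_le_add_right (hT _ (h0T a ha)) 1)
  obtain ⟨φ₁, h1, h1A, h1W⟩ := h0.exists_union_into_independent hd (W := W \ A₀)
    disjoint_sdiff (T ∪ E)ᶜ (by
      intro z hz a ha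
      simp only [mem_compl, mem_union, not_or, hE, mem_biUnion, mem_insert, mem_nbrs, not_exists,
        not_and] at hz
      exact ⟨fun h => (hz.2 a ha).1 h.symm, (hz.2 a ha).2⟩) (by
      have h2 := card_add_card_compl (T ∪ E)
      have h3 := card_union_le T E
      have h4 := Nat.mul_le_mul_left (d + 1) (card_le_card (sdiff_subset (s := W) (t := A₀)))
      omega)
  rw [union_sdiff_self_eq_union] at h1
  set A := A₀ ∪ W with hA
  have h1T : ∀ a ∈ A, φ₁ a ∉ T := by
    intro a ha
    by_cases ha' : a ∈ A₀
    · rw [h1A a ha']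
      exact h0T a ha'
    · have := h1W a (mem_sdiff.2 ⟨(mem_union.1 ha).resolve_left ha', ha'⟩)
      exact fun h => mem_compl.1 this (mem_union_left _ h)
  have hAU : A ⊆ Uᶜ := by
    intro a ha
    rw [mem_compl]
    rcases mem_union.1 ha with ha' | ha'
    · rcases mem_union.1 ha' with ha'' | ha''
      · rw [mem_singleton.1 ha'']
        exact hcU
      · exact hQU a ha''
    · exact hWU a ha'
  obtain ⟨φ₂, h2, h2A, -⟩ := h1.exists_greedy hAU Tᶜ D (fun _ => D)
    (fun a ha => hT _ (h1T a ha)) (fun z hz => hT z (mem_compl.1 hz)) (fun _ _ => le_rfl) (by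
      intro X hAX hXU
      obtain ⟨v, hv, hvc⟩ := exists_card_nbrs_inter_le_of_three_core (Y := A₀) hW hAX
        subset_union_right (by
          intro a ha
          rw [mem_sdiff] at ha
          exact (mem_union.1 ha.1).resolve_right ha.2)
      refine ⟨v, hv, ?_⟩
      rw [sum_const, smul_eq_mul]
      have h3 : #(nbrs G v ∩ X) * D ≤ (3 + #Q) * D := Nat.mul_le_mul_right _ (by omega)
      have h4 := card_sdiff_add_card_eq_card hAX.1
      have h5 := card_le_card hXU
      have h6 := card_add_card_compl U
      have h7 := card_add_card_compl T
      have h8 := le_card_sdiff (A.image φ₁) Tᶜ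
      have h9 : #(A.image φ₁) ≤ #A := card_image_le
      omega)
  have h2c : φ₂ c = x := by
    rw [h2A c (by simp [hA, hA₀]), h1A c (by simp [hA₀]), h0c c (by simp)]
  have hYim : Y ⊆ Uᶜ.image φ₂ := by
    intro z hz
    rw [← hgim, mem_image] at hz
    obtain ⟨q, hq, rfl⟩ := hz
    refine mem_image.2 ⟨q, mem_compl.2 (hQU q hq), ?_⟩
    rw [h2A q (by simp [hA, hA₀, hq]), h1A q (by simp [hA₀, hq]), h0Q q hq]
  obtain ⟨φ₃, h3⟩ := h2.exists_union_of_hall (U := U) disjoint_compl_left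
    (fun u hu v hv huv => hcU (hUadj v hv u huv ▸ hu))
    (fun _ => (Uᶜ.image φ₂ ∪ (nbrs H x \ Y))ᶜ) (by
      intro u hu z hz a ha
      simp only [mem_compl, mem_union, not_or, mem_image, not_exists, not_and, mem_sdiff,
        mem_nbrs, not_not] at hz ha
      refine ⟨hz.1 a ha, fun hau hH => ?_⟩
      rw [hUadj u hu a hau, h2c] at hH
      obtain ⟨b, hb, hbz⟩ := mem_image.1 (hYim (hz.2 hH))
      exact hz.1 b (mem_compl.1 hb) hbz) (by
      intro S hS
      rcases S.eq_empty_or_nonempty with rfl | ⟨u, hu⟩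
      · simp
      refine le_trans ?_ (card_le_card (subset_biUnion_of_mem (fun _ => (Uᶜ.image φ₂ ∪
        (nbrs H x \ Y))ᶜ) hu))
      have h4 := card_le_card hS
      have h5 := card_add_card_compl (Uᶜ.image φ₂ ∪ (nbrs H x \ Y))
      have h6 := card_union_le (Uᶜ.image φ₂) (nbrs H x \ Y)
      have h7 : #(Uᶜ.image φ₂) ≤ #Uᶜ := card_image_le
      have h8 := card_add_card_compl U
      omega)
  rw [union_comm, union_compl] at h3
  exact h3.isContained_compl

theorem not_adj_of_card_nbrs_eq_one (hG : G.Connected) (hn : 3 ≤ Fintype.card V) {u v : V}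
    (hu : #(nbrs G u) = 1) (hv : #(nbrs G v) = 1) : ¬ G.Adj u v := by
  intro huv
  have h1 : ∀ w, G.Adj u w → w = v := fun w hw =>
    card_le_one.1 hu.le w (mem_nbrs.2 hw) v (mem_nbrs.2 huv)
  have h2 : ∀ w, G.Adj v w → w = u := fun w hw =>
    card_le_one.1 hv.le w (mem_nbrs.2 hw) u (mem_nbrs.2 huv.symm)
  obtain ⟨w, hw⟩ : ∃ w, w ∉ ({u, v} : Finset V) := by
    by_contra! hcon
    have h3 := card_le_card (show univ ⊆ ({u, v} : Finset V) from fun w _ => hcon w)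
    have h4 := card_le_two (a := u) (b := v)
    rw [card_univ] at h3
    omega
  obtain ⟨p⟩ := hG.preconnected u w
  obtain ⟨d, -, hd1, hd2⟩ := p.exists_boundary_dart (({u, v} : Finset V) : Set V) (by simp) hw
  simp only [coe_insert, coe_singleton, Set.mem_insert_iff, Set.mem_singleton_iff, not_or]
    at hd1 hd2
  rcases hd1 with hd | hd
  · exact hd2.2 (h1 _ (hd ▸ d.adj))
  · exact hd2.1 (h2 _ (hd ▸ d.adj))

/-- A set `S` of leaves violating Hall's condition leaves a set `J` of free vertices joined in `H`
to all images `P` of the parents of `S`. Each parent has fewer than `m` leaves, so a small `P` means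
a small `S` and hence a large `J`. -/
theorem isContained_compl_of_many_leaves {d D h k m : ℕ} {W : Finset V} {T : Finset Ω}
    (hG : G.Connected) (hn : 3 ≤ Fintype.card V)
    (hk : k ≤ 2 * h + 1) (hfree : ¬ SimpleGraph.pathGraph k ⊑ H)
    (hd : ∀ X : Finset Ω, X.Nonempty → ∃ v ∈ X, #(nbrs H v ∩ X) ≤ d)
    (hN : Fintype.card Ω + 1 = Fintype.card V + h) (hh : 1 ≤ h)
    (hT : ∀ z, z ∉ T → #(nbrs H z) ≤ D)
    (hW3 : ∀ v ∈ W, 3 ≤ #(nbrs G v ∩ W))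
    (hW : ∀ X, W ⊂ X → ∃ v ∈ X \ W, #(nbrs G v ∩ X) ≤ 2)
    (hcore : (d + 1) * #W + #T ≤ Fintype.card Ω) (hDm : D < m) (hTm : #T + 2 * D ≤ m)
    (hm : ∀ p, #((nbrs G p).filter fun u => #(nbrs G u) = 1) < m)
    (hL : h * m ≤ #(univ.filter fun u => #(nbrs G u) = 1)) : G ⊑ Hᶜ := by
  set U := univ.filter fun u => #(nbrs G u) = 1 with hU
  have hmemU : ∀ u, u ∈ U ↔ #(nbrs G u) = 1 := fun u => by simp [hU]
  have hmU : m ≤ #U := le_trans (by nlinarith) hL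
  choose! par hpar using fun u (hu : u ∈ U) => card_eq_one.1 ((hmemU u).1 hu)
  have hpadj : ∀ u ∈ U, G.Adj u (par u) := fun u hu => by
    rw [← mem_nbrs, hpar u hu]
    exact mem_singleton_self _
  have hindep : ∀ u ∈ U, ∀ v ∈ U, ¬ G.Adj u v := fun u hu v hv =>
    not_adj_of_card_nbrs_eq_one hG hn ((hmemU u).1 hu) ((hmemU v).1 hv)
  have hparU : ∀ u ∈ U, par u ∈ Uᶜ := fun u hu =>
    mem_compl.2 fun h => hindep u hu _ h (hpadj u hu)
  have hWU : W ⊆ Uᶜ := fun u hu => mem_compl.2 fun huU => by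
    have h1 := hW3 u hu
    have h2 := card_le_card (inter_subset_left (s₁ := nbrs G u) (s₂ := W))
    have h3 := (hmemU u).1 huU
    omega
  have hΩ : Nonempty Ω := Fintype.card_pos_iff.1 (by omega)
  obtain ⟨φ₁, h1, -, h1W⟩ := (isPackingOn_empty (G := G) (H := H)
    (fun _ => Classical.arbitrary Ω)).exists_union_into_independent hd (W := W) (by simp) Tᶜ
    (by simp) (by
      have := card_add_card_compl T
      omega)
  rw [empty_union] at h1
  have h6 := card_add_card_compl U
  obtain ⟨φ, h2, h2A, h2Y⟩ := h1.exists_greedy hWU Tᶜ D (fun _ => D)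
    (fun a ha => hT _ (mem_compl.1 (h1W a ha))) (fun z hz => hT z (mem_compl.1 hz))
    (fun _ _ => le_rfl) (by
      intro X hAX hXU
      obtain ⟨v, hv, hvc⟩ := hW X hAX
      refine ⟨v, hv, ?_⟩
      rw [sum_const, smul_eq_mul]
      have h3 : #(nbrs G v ∩ X) * D ≤ 2 * D := Nat.mul_le_mul_right _ hvc
      have h4 := card_sdiff_add_card_eq_card hAX.1
      have h5 := card_le_card hXU
      have h7 := card_add_card_compl T
      have h8 := le_card_sdiff (W.image φ₁) Tᶜ
      have h9 : #(W.image φ₁) ≤ #W := card_image_le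
      omega)
  have hφT : ∀ a ∈ Uᶜ, φ a ∉ T := by
    intro a ha
    by_cases haW : a ∈ W
    · rw [h2A a haW]
      exact mem_compl.1 (h1W a haW)
    · exact mem_compl.1 (h2Y a (mem_sdiff.2 ⟨ha, haW⟩))
  obtain ⟨φ₃, h3⟩ := h2.exists_union_of_hall (U := U) disjoint_compl_left hindep
    (fun u => (Uᶜ.image φ)ᶜ \ nbrs H (φ (par u))) (by
      intro u hu z hz a ha
      simp only [mem_compl, mem_image, not_exists, not_and, mem_sdiff, mem_nbrs] at hz ha
      refine ⟨hz.1 a ha, fun hau hH => ?_⟩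
      have : a ∈ nbrs G u := mem_nbrs.2 hau.symm
      rw [hpar u hu, mem_singleton] at this
      exact hz.2 (this ▸ hH)) (by
      intro S hS
      rcases S.eq_empty_or_nonempty with rfl | ⟨u₀, hu₀⟩
      · simp
      by_contra! hcon
      set t : V → Finset Ω := fun u => (Uᶜ.image φ)ᶜ \ nbrs H (φ (par u)) with ht
      set J := (Uᶜ.image φ)ᶜ \ S.biUnion t with hJ
      set P := (S.image par).image φ with hP
      have hJP : ∀ a ∈ J, ∀ b ∈ P, H.Adj a b := by
        intro a ha b hb
        simp only [hP, mem_image] at hb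
        obtain ⟨_, ⟨u, hu, rfl⟩, rfl⟩ := hb
        simp only [hJ, mem_sdiff, mem_biUnion, not_exists, not_and] at ha
        have := ha.2 u hu
        simp only [ht, mem_sdiff, not_and, not_not, mem_nbrs] at this
        exact (this ha.1).symm
      have hPc : #P = #(S.image par) := card_image_of_injOn (h2.1.mono (by
        intro p hp
        rw [mem_coe, mem_image] at hp
        obtain ⟨u, hu, rfl⟩ := hp
        exact hparU u (hS hu)))
      have hSc : #S ≤ (m - 1) * #P := by
        rw [hPc]
        refine card_le_mul_card_image S (m - 1) fun p hp => ?_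
        refine (card_le_card ?_).trans (Nat.le_sub_one_of_lt (hm p))
        intro u hu
        rw [mem_filter] at hu
        rw [mem_filter, mem_nbrs]
        exact ⟨hu.2 ▸ (hpadj u (hS hu.1)).symm, (hmemU u).1 (hS hu.1)⟩
      have hJc : #U + h ≤ #J + #S := by
        have h4 : _ ≤ #J := le_card_sdiff (S.biUnion t) (Uᶜ.image φ)ᶜ
        have h5 := card_add_card_compl (Uᶜ.image φ)
        have h7 : #(Uᶜ.image φ) ≤ #Uᶜ := card_image_le
        omega
      have hSU := card_le_card hS
      obtain ⟨m', rfl⟩ : ∃ m', m = m' + 1 := Nat.exists_eq_add_of_lt (by omega : 0 < m) |>.imp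
        fun a ha => by omega
      simp only [Nat.add_sub_cancel] at hSc
      -- For `#P ≥ h` the sets `J` and `P` contain a `K_{h,h+1}`. For `#P < h` the count gives `#J ≥
      -- m > D`, although `J` lies in the neighbourhood of a vertex outside `T`.
      by_cases hPh : h + 1 ≤ #P
      · exact hfree (pathGraph_isContained_of_complete_bipartite hk J P (by omega) hPh hJP)
      by_cases hPh' : h ≤ #P
      · have hPe : #P = h := by omega
        rw [hPe] at hSc
        exact hfree (pathGraph_isContained_of_complete_bipartite hk P J hPh' (by nlinarith)
          fun a ha b hb => (hJP b hb a ha).symm)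
      · have h4 : J ⊆ nbrs H (φ (par u₀)) := fun z hz =>
          mem_nbrs.2 (hJP z hz _ (mem_image_of_mem _ (mem_image_of_mem _ hu₀))).symm
        have h5 := (card_le_card h4).trans (hT _ (hφT _ (hparU u₀ (hS hu₀))))
        have h7 : m' * (#P + 1) ≤ m' * h := Nat.mul_le_mul_left _ (by omega)
        nlinarith)
  rw [union_comm, union_compl] at h3
  exact h3.isContained_compl

end LeafCases

/-! ### Graphs with few leaves -/

section FewLeaves

variable {V Ω : Type*} [Fintype V] [Fintype Ω] {G : SimpleGraph V} {H : SimpleGraph Ω}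

/-- If `h` vertices each had fewer than `y` non-neighbours, they would have `h + 1` common
neighbours, producing a `K_{h,h+1}`. The exceptional set is padded to exactly `h - 1` vertices, the
number that may remain unused. -/
theorem exists_card_eq_forall_notMem_card_nbrs_add_le {k h y : ℕ} (hk : k ≤ 2 * h + 1)
    (hfree : ¬ SimpleGraph.pathGraph k ⊑ H) (hh : 1 ≤ h)
    (hy : h * y + h + 1 ≤ Fintype.card Ω) :
    ∃ Z : Finset Ω, #Z + 1 = h ∧ ∀ x, x ∉ Z → #(nbrs H x) + y ≤ Fintype.card Ω := by
  set B := univ.filter fun x => Fintype.card Ω < #(nbrs H x) + y with hB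
  have hBc : #B < h := by
    by_contra! hcon
    obtain ⟨A, hAB, hA⟩ := exists_subset_card_eq hcon
    refine hfree (pathGraph_isContained_of_complete_bipartite hk A
      (A.biUnion fun x => (nbrs H x)ᶜ)ᶜ hA.ge ?_ ?_)
    · have h1 : #(A.biUnion fun x => (nbrs H x)ᶜ) ≤ #A * y := by
        refine card_biUnion_le_card_mul _ _ _ fun x hx => ?_
        have h2 := card_add_card_compl (nbrs H x)
        have h3 := (mem_filter.1 (hAB hx)).2
        omega
      have h4 := card_add_card_compl (A.biUnion fun x => (nbrs H x)ᶜ)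
      rw [hA] at h1
      omega
    · intro a ha b hb
      simp only [mem_compl, mem_biUnion, not_exists, not_and, not_not, mem_nbrs] at hb
      exact hb a ha
  obtain ⟨Z, hBZ, -, hZ⟩ := exists_subsuperset_card_eq (subset_univ B) (n := h - 1) (by omega)
    (by rw [card_univ]; omega)
  refine ⟨Z, by omega, fun x hx => ?_⟩
  by_contra! hcon
  exact hx (hBZ (mem_filter.2 ⟨mem_univ _, hcon⟩))

/-- The set `Z` stays unused, so every other vertex of `H` must be hit, including the high-degree
ones in `T'`. These receive the interior vertices `U₁`, whose neighbours are placed at once while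
there is plenty of room. After the greedy phase the separated vertices `U \ U₁` fill what remains.
-/
theorem isContained_compl_of_many_interiorVerts {d D h k y : ℕ} {W U : Finset V}
    {T : Finset Ω} (hk : k ≤ 2 * h + 1) (hfree : ¬ SimpleGraph.pathGraph k ⊑ H)
    (hd : ∀ X : Finset Ω, X.Nonempty → ∃ v ∈ X, #(nbrs H v ∩ X) ≤ d)
    (hN : Fintype.card Ω + 1 = Fintype.card V + h) (hh : 1 ≤ h)
    (hT : ∀ z, z ∉ T → #(nbrs H z) ≤ D)
    (hW3 : ∀ v ∈ W, 3 ≤ #(nbrs G v ∩ W))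
    (hW : ∀ X, W ⊂ X → ∃ v ∈ X \ W, #(nbrs G v ∩ X) ≤ 2)
    (hUint : U ⊆ interiorVerts G)
    (hUsep : ∀ u ∈ U, ∀ v ∈ U, u ≠ v → Disjoint (insert u (nbrs G u)) (insert v (nbrs G v)))
    (hy : h * y + h + 1 ≤ Fintype.card Ω) (hcore : (d + 1) * #W + #T + h ≤ Fintype.card Ω)
    (hyT : 3 * #T + D + #W + h ≤ y) (hUc : #T + 3 * D ≤ #U) : G ⊑ Hᶜ := by
  obtain ⟨Z, hZ, hZy⟩ := exists_card_eq_forall_notMem_card_nbrs_add_le hk hfree hh hy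
  set T' := T \ Z with hT'
  have hT'c : #T' ≤ #T := card_le_card sdiff_subset
  set Λ := (Z ∪ T')ᶜ with hΛ
  have hΛc : #Λ + #T' = Fintype.card V := by
    have h1 := card_add_card_compl (Z ∪ T')
    have h2 := card_union_of_disjoint (disjoint_sdiff (s := Z) (t := T))
    rw [← hT'] at h2
    rw [← hΛ] at h1
    omega
  have hΛD : ∀ z ∈ Λ, #(nbrs H z) ≤ D := by
    intro z hz
    simp only [hΛ, hT', mem_compl, mem_union, mem_sdiff, not_or, not_and, not_not] at hz
    exact hT z fun h => hz.1 (hz.2 h)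
  have hint := fun u (hu : u ∈ U) => mem_interiorVerts.1 (hUint hu)
  have hclosed : ∀ u ∈ U, ∀ v ∈ U, ∀ a, a ∈ insert u (nbrs G u) → a ∈ insert v (nbrs G v) →
      u = v := by
    intro u hu v hv a ha hb
    by_contra hne
    exact disjoint_left.1 (hUsep u hu v hv hne) ha hb
  have hUindep : ∀ u ∈ U, ∀ v ∈ U, ¬ G.Adj u v := by
    intro u hu v hv huv
    have := hclosed u hu v hv v (mem_insert_of_mem (mem_nbrs.2 huv)) (mem_insert_self _ _)
    exact huv.ne this
  have hW2 : ∀ w ∈ W, #(nbrs G w) ≠ 2 := by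
    intro w hw h
    have h1 := hW3 w hw
    have h2 := card_le_card (inter_subset_left (s₁ := nbrs G w) (s₂ := W))
    omega
  have hΩ : Nonempty Ω := Fintype.card_pos_iff.1 (by nlinarith)
  obtain ⟨φ₁, h1, -, h1W⟩ := (isPackingOn_empty (G := G) (H := H)
    (fun _ => Classical.arbitrary Ω)).exists_union_into_independent hd (W := W) (by simp) Λ
    (by simp) (by omega)
  rw [empty_union] at h1
  obtain ⟨U₁, hU₁, hU₁c⟩ := exists_subset_card_eq (show #T' ≤ #U by omega)
  obtain ⟨g, hg, hgT⟩ := exists_injOn_mapsTo_of_card_le φ₁ U₁ T' hU₁c.le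
  have hgim : U₁.image g = T' := eq_of_subset_of_card_le (image_subset_iff.2 hgT)
    (by rw [card_image_of_injOn hg, hU₁c])
  have hWU : Disjoint W U := disjoint_left.2 fun w hw hu => hW2 w hw (hint w hu).1
  have hΛT' : ∀ z ∈ Λ, z ∉ T' := fun z hz h => mem_compl.1 hz (mem_union_right _ h)
  obtain ⟨φ₂, h2, h2W, h2U⟩ := h1.exists_union (W := U₁) (g := g)
    (isPackingOn_of_independent hg fun u hu v hv => hUindep u (hU₁ hu) v (hU₁ hv))
    (hWU.mono_right hU₁)
    (fun a ha w hw h => hΛT' _ (h1W a ha) (h ▸ hgT w hw))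
    (fun a ha w hw haw => absurd ((hint w (hU₁ hw)).2 a haw.symm).1 (hW2 a ha))
  set A := W ∪ U₁ with hA
  set Y := A ∪ U₁.biUnion (nbrs G) with hY
  have hAc : #A = #W + #T' := by
    rw [hA, card_union_of_disjoint (hWU.mono_right hU₁), hU₁c]
  have hnc : #(U₁.biUnion (nbrs G)) ≤ #T' * 2 := by
    rw [← hU₁c]
    exact card_biUnion_le_card_mul _ _ _ fun u hu => (hint u (hU₁ hu)).1.le
  -- A neighbour of some `u ∈ U₁` has just one other neighbour, not in `U₁` by separation. So it
  -- loses at most `N - y` places to `u` and `D` to the other neighbour; `hyT` is the resulting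
  -- count.
  obtain ⟨φ₃, h3, h3A, h3Y⟩ := h2.exists_greedy (Y := Y) subset_union_left Λ D
    (fun w => if w ∈ U₁ then Fintype.card Ω - y else D) (by
      intro a ha
      split_ifs with haU
      · rw [h2U a haU]
        have := hZy (g a) (mem_sdiff.1 (hgT a haU)).2
        omega
      · have haW := (mem_union.1 ha).resolve_right haU
        rw [h2W a haW]
        exact hΛD _ (h1W a haW)) hΛD (by
      intro w hw
      rw [if_neg fun h => hw (mem_union_right _ h)]) (by
      intro X hAX hXY
      obtain ⟨v, hv, hvA⟩ := exists_of_ssubset hAX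
      have hvY := (mem_union.1 (hXY hv)).resolve_left hvA
      obtain ⟨u, hu, hvu⟩ := mem_biUnion.1 hvY
      refine ⟨v, mem_sdiff.2 ⟨hv, hvA⟩, ?_⟩
      have hv2 := ((hint u (hU₁ hu)).2 v (mem_nbrs.1 hvu)).1
      have huv : u ∈ nbrs G v := mem_nbrs.2 (mem_nbrs.1 hvu).symm
      have hsum : ∑ w ∈ nbrs G v ∩ X, (if w ∈ U₁ then Fintype.card Ω - y else D) ≤
          Fintype.card Ω - y + D := by
        refine (sum_le_sum_of_subset inter_subset_left).trans ?_
        rw [← add_sum_erase _ _ huv, if_pos hu]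
        refine Nat.add_le_add_left ?_ _
        rw [sum_congr rfl (g := fun _ => D)]
        · rw [sum_const, card_erase_of_mem huv, hv2]
          simp
        · intro w hw
          rw [mem_erase, mem_nbrs] at hw
          refine if_neg fun hwU => hw.1 ?_
          exact hclosed w (hU₁ hwU) u (hU₁ hu) v (mem_insert_of_mem (mem_nbrs.2 hw.2.symm))
            (mem_insert_of_mem hvu)
      have h4 : #(X \ A) ≤ #(U₁.biUnion (nbrs G)) := card_le_card fun x hx =>
        (mem_union.1 (hXY (mem_sdiff.1 hx).1)).resolve_left (mem_sdiff.1 hx).2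
      have h5 : Λ \ W.image φ₂ ⊆ Λ \ A.image φ₂ := by
        intro z hz
        rw [mem_sdiff] at hz ⊢
        refine ⟨hz.1, fun h => ?_⟩
        rw [hA, image_union, mem_union] at h
        rcases h with h | h
        · exact hz.2 h
        · obtain ⟨u', hu', rfl⟩ := mem_image.1 h
          rw [h2U u' hu'] at hz
          exact hΛT' _ hz.1 (hgT u' hu')
      have h6 := card_le_card h5
      have h7 := le_card_sdiff (W.image φ₂) Λ
      have h8 : #(W.image φ₂) ≤ #W := card_image_le
      have h9 : y ≤ Fintype.card Ω := by nlinarith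
      omega)
  set U₂ := U \ U₁ with hU₂
  have hU₂c : #U₂ + #T' = #U := by
    rw [← hU₁c]
    exact card_sdiff_add_card_eq_card hU₁
  have hnU : ∀ u ∈ U, ∀ a, G.Adj u a → a ∉ U := fun u hu a hua ha => hUindep u hu a ha hua
  have hYU : Y ⊆ U₂ᶜ := by
    intro a ha
    rw [mem_compl, hU₂, mem_sdiff]
    rintro ⟨haU, haU₁⟩
    rw [hY, hA, mem_union, mem_union, mem_biUnion] at ha
    rcases ha with (ha | ha) | ⟨u, hu, ha⟩
    · exact disjoint_left.1 hWU ha haU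
    · exact haU₁ ha
    · exact hnU u (hU₁ hu) a (mem_nbrs.1 ha) haU
  have h3Λ : ∀ a ∈ Y, a ∉ U₁ → φ₃ a ∈ Λ := by
    intro a ha haU
    by_cases haW : a ∈ W
    · rw [h3A a (mem_union_left _ haW), h2W a haW]
      exact h1W a haW
    · exact h3Y a (mem_sdiff.2 ⟨ha, fun h => (mem_union.1 h).elim haW haU⟩)
  have h3U : ∀ u ∈ U₁, φ₃ u = g u := fun u hu => by
    rw [h3A u (mem_union_right _ hu), h2U u hu]
  have hU₁Y : U₁ ⊆ Y := subset_union_right.trans subset_union_left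
  have hnΩ : ∀ z : Ω, #(nbrs H z) ≤ Fintype.card Ω := fun z => card_le_univ _
  have hU₂compl := card_add_card_compl U₂
  -- The trivial bound `N` suffices on `U₁`: all neighbours of `U₁` lie in `Y`, so no vertex placed
  -- here is adjacent to it.
  obtain ⟨φ₄, h4, h4Y, h4U⟩ := h3.exists_greedy hYU Λ D
    (fun w => if w ∈ U₁ then Fintype.card Ω else D) (by
      intro a ha
      split_ifs with haU
      · exact hnΩ _
      · exact hΛD _ (h3Λ a ha haU)) hΛD (by
      intro w hw
      rw [if_neg fun h => hw (hU₁Y h)]) (by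
      intro X hYX hXU
      obtain ⟨v, hv, hvc⟩ : ∃ v ∈ X \ Y, #(nbrs G v ∩ X) ≤ 2 := by
        obtain ⟨v, hv, hvc⟩ := hW (X \ (Y \ W)) (by
          have hWY : W ⊆ Y := subset_union_left.trans subset_union_left
          obtain ⟨x, hx, hxY⟩ := exists_of_ssubset hYX
          refine ⟨fun w hw => mem_sdiff.2 ⟨hYX.1 (hWY hw), fun h => (mem_sdiff.1 h).2 hw⟩,
            fun hs => ?_⟩
          exact hxY (hWY (hs (mem_sdiff.2 ⟨hx, fun h => hxY (mem_sdiff.1 h).1⟩))))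
        simp only [mem_sdiff, not_and, not_not] at hv
        have hvY : v ∉ Y := fun h => hv.2 (hv.1.2 h)
        refine ⟨v, mem_sdiff.2 ⟨hv.1.1, hvY⟩, ?_⟩
        -- A vertex at distance two from `U₁` has degree two in `G`, by interiority. Any other `v`
        -- has all its already placed neighbours in `W`, so deleting `Y \ W` loses nothing.
        by_cases hex : ∃ u ∈ U₁, ∃ a, G.Adj u a ∧ G.Adj a v
        · obtain ⟨u, hu, a, hua, hav⟩ := hex
          exact (card_le_card inter_subset_left).trans (((hint u (hU₁ hu)).2 a hua).2 v hav).le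
        · refine (card_le_card ?_).trans hvc
          intro w hw
          rw [mem_inter, mem_nbrs] at hw
          refine mem_inter.2 ⟨mem_nbrs.2 hw.1, mem_sdiff.2 ⟨hw.2, fun hwY => ?_⟩⟩
          obtain ⟨hwY, hwW⟩ := mem_sdiff.1 hwY
          rw [hY, hA, mem_union, mem_union, mem_biUnion] at hwY
          rcases hwY with (h | h) | ⟨u, hu, h⟩
          · exact hwW h
          · exact hvY (mem_union_right _ (mem_biUnion.2 ⟨w, h, mem_nbrs.2 hw.1.symm⟩))
          · exact hex ⟨u, hu, w, mem_nbrs.1 h, hw.1.symm⟩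
      refine ⟨v, hv, ?_⟩
      have hsum : ∑ w ∈ nbrs G v ∩ X, (if w ∈ U₁ then Fintype.card Ω else D) ≤ 2 * D := by
        rw [sum_congr rfl (g := fun _ => D)]
        · rw [sum_const, smul_eq_mul]
          exact Nat.mul_le_mul_right _ hvc
        · intro w hw
          rw [mem_inter, mem_nbrs] at hw
          refine if_neg fun hwU => (mem_sdiff.1 hv).2 ?_
          exact mem_union_right _ (mem_biUnion.2 ⟨w, hwU, mem_nbrs.2 hw.1.symm⟩)
      have h5 : Λ \ (Y \ U₁).image φ₃ ⊆ Λ \ Y.image φ₃ := by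
        intro z hz
        simp only [mem_sdiff, mem_image, not_exists, not_and] at hz ⊢
        refine ⟨hz.1, fun a ha haz => ?_⟩
        by_cases haU : a ∈ U₁
        · rw [h3U a haU] at haz
          exact hΛT' z hz.1 (haz ▸ hgT a haU)
        · exact hz.2 a ⟨ha, haU⟩ haz
      have h6 := card_le_card h5
      have h7 := le_card_sdiff ((Y \ U₁).image φ₃) Λ
      have h8 : #((Y \ U₁).image φ₃) ≤ #(Y \ U₁) := card_image_le
      have h9 := card_sdiff_add_card_eq_card hU₁Y
      have h10 := card_sdiff_add_card_eq_card hYX.1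
      have h11 := card_le_card hXU
      omega)
  have h4Λ : ∀ a ∈ U₂ᶜ, a ∉ U₁ → φ₄ a ∈ Λ := by
    intro a ha haU
    by_cases haY : a ∈ Y
    · rw [h4Y a haY]
      exact h3Λ a haY haU
    · exact h4U a (mem_sdiff.2 ⟨ha, haY⟩)
  set B := (Z ∪ U₂ᶜ.image φ₄)ᶜ with hB
  have hBc : #U₂ ≤ #B := by
    have h5 := card_add_card_compl (Z ∪ U₂ᶜ.image φ₄)
    have h6 := card_union_le Z (U₂ᶜ.image φ₄)
    have h7 : #(U₂ᶜ.image φ₄) ≤ #U₂ᶜ := card_image_le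
    rw [← hB] at h5
    omega
  have hBΛ : B ⊆ Λ := by
    intro z hz
    simp only [hB, mem_compl, mem_union, not_or] at hz
    rw [hΛ, mem_compl, mem_union]
    rintro (h | h)
    · exact hz.1 h
    · rw [← hgim, mem_image] at h
      obtain ⟨u, hu, rfl⟩ := h
      refine hz.2 (mem_image.2 ⟨u, hYU (hU₁Y hu), ?_⟩)
      rw [h4Y u (hU₁Y hu), h3U u hu]
  have hU₂U : U₂ ⊆ U := sdiff_subset
  have hnb : ∀ u ∈ U₂, ∀ a, G.Adj u a → a ∈ U₂ᶜ := fun u hu a hua =>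
    mem_compl.2 fun h => hnU u (hU₂U hu) a hua (hU₂U h)
  have hnbΛ : ∀ u ∈ U₂, ∀ a, G.Adj u a → φ₄ a ∈ Λ := fun u hu a hua =>
    h4Λ a (hnb u hu a hua) fun h => hnU u (hU₂U hu) a hua (hU₁ h)
  obtain ⟨φ₅, h5⟩ := h4.exists_union_of_hall (U := U₂) disjoint_compl_left
    (fun u hu v hv => hUindep u (hU₂U hu) v (hU₂U hv))
    (fun u => B \ (nbrs G u).biUnion fun a => nbrs H (φ₄ a)) (by
      intro u hu z hz a ha
      simp only [hB, mem_compl, mem_image, not_exists, not_and, mem_sdiff, mem_nbrs, mem_union,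
        not_or, mem_biUnion] at hz ha
      exact ⟨hz.1.2 a ha, fun hau hH => hz.2 a hau.symm hH⟩) (by
      intro S hS
      rcases S.eq_empty_or_nonempty with rfl | ⟨u₀, hu₀⟩
      · simp
      set t : V → Finset Ω := fun u => B \ (nbrs G u).biUnion fun a => nbrs H (φ₄ a) with ht
      have hSU := card_le_card hS
      -- If `#S > D`, a vertex of `B` outside every `t u` would be adjacent to the images of `#S`
      -- distinct neighbours, by separation, against its degree bound. If `#S ≤ D`, one `t u₀`
      -- already has at least `#U₂ - 2 * D ≥ D` elements.
      by_cases hSD : D < #S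
      · refine (hSU.trans hBc).trans (card_le_card fun z hz => ?_)
        by_contra hcon
        simp only [ht, mem_biUnion, mem_sdiff, not_exists, not_and, mem_nbrs, not_forall, not_not,
          exists_prop] at hcon
        choose! a ha haH using fun u hu => hcon u hu hz
        have hinj : Set.InjOn (fun u => φ₄ (a u)) S := by
          intro u hu v hv huv
          have := h4.1 (mem_coe.2 (hnb u (hS hu) _ (ha u hu)))
            (mem_coe.2 (hnb v (hS hv) _ (ha v hv))) huv
          exact hclosed u (hU₂U (hS hu)) v (hU₂U (hS hv)) (a u)
            (mem_insert_of_mem (mem_nbrs.2 (ha u hu)))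
            (this ▸ mem_insert_of_mem (mem_nbrs.2 (ha v hv)))
        have h6 := card_le_card (show S.image (fun u => φ₄ (a u)) ⊆ nbrs H z from
          image_subset_iff.2 fun u hu => mem_nbrs.2 (haH u hu).symm)
        rw [card_image_of_injOn hinj] at h6
        have h7 := hΛD z (hBΛ hz)
        omega
      · refine le_trans ?_ (card_le_card (subset_biUnion_of_mem t hu₀))
        have h6 := le_card_sdiff ((nbrs G u₀).biUnion fun a => nbrs H (φ₄ a)) B
        have h7 : #((nbrs G u₀).biUnion fun a => nbrs H (φ₄ a)) ≤ #(nbrs G u₀) * D :=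
          card_biUnion_le_card_mul _ _ _ fun a ha => hΛD _ (hnbΛ u₀ (hS hu₀) a (mem_nbrs.1 ha))
        rw [(hint u₀ (hU₂U (hS hu₀))).1] at h7
        have h8 : _ ≤ #(t u₀) := h6
        omega)
  rw [union_comm, union_compl] at h5
  exact h5.isContained_compl

end FewLeaves

/-! ### Choice of parameters and the case distinction -/

section UpperBound

variable {V Ω : Type*} [Fintype V] [Fintype Ω] {G : SimpleGraph V} {H : SimpleGraph Ω}

theorem card_filter_lt_card_nbrs_le {k n D : ℕ} (hk : 2 ≤ k)
    (hfree : ¬ SimpleGraph.pathGraph k ⊑ H) (hN : Fintype.card Ω + 1 = n + k / 2)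
    (hkn : k ^ 2 ≤ n) (hD : k * n < (D + 1) * (D + 1)) :
    #(univ.filter fun x => D < #(nbrs H x)) ≤ 2 * D + 1 := by
  set T := univ.filter fun x => D < #(nbrs H x)
  have h1 : #T * (D + 1) ≤ ∑ x ∈ T, #(nbrs H x) := by
    have := card_nsmul_le_sum T (fun x => #(nbrs H x)) (D + 1) fun x hx => (mem_filter.1 hx).2
    simpa using this
  have h2 : ∑ x ∈ T, #(nbrs H x) ≤ ∑ x, #(nbrs H x) := sum_le_sum_of_subset (subset_univ _)
  have h3 := sum_card_nbrs_inter_le_of_degenerate (H := H) (k - 2)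
    (exists_card_nbrs_inter_le hk hfree) univ
  simp only [inter_univ, card_univ] at h3
  obtain ⟨j, rfl⟩ := Nat.exists_eq_add_of_le hk
  simp only [Nat.add_sub_cancel_left] at h3
  have h4 : Fintype.card Ω ≤ n + j := by omega
  have h5 : 2 * j * Fintype.card Ω ≤ 2 * j * (n + j) := Nat.mul_le_mul_left _ h4
  have h6 : 2 * j * (n + j) ≤ 2 * ((2 + j) * n) := by nlinarith
  have h7 : #T * (D + 1) < (2 * (D + 1)) * (D + 1) := by nlinarith
  have h8 := Nat.lt_of_mul_lt_mul_right h7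
  omega

theorem isContained_compl_of_sparse_of_path_free {k s : ℕ} (hG : G.Connected)
    (hs : ∑ v, #(nbrs G v) ≤ 2 * Fintype.card V + s) (hsk : 72 * k ^ 2 * s ≤ Fintype.card V)
    (hk : 2 ≤ k) (hnk : 3424 * k ^ 4 ≤ Fintype.card V)
    (hc : ∀ c, Fintype.card V < 36 * k * (Fintype.card V - #(nbrs G c)) ^ 2)
    (hN : Fintype.card Ω + 1 = Fintype.card V + k / 2)
    (hfree : ¬ SimpleGraph.pathGraph k ⊑ H) : G ⊑ Hᶜ := by
  obtain ⟨n, hn⟩ : ∃ n, n = Fintype.card V := ⟨_, rfl⟩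
  obtain ⟨h, hh⟩ : ∃ h, h = k / 2 := ⟨_, rfl⟩
  obtain ⟨D, hD⟩ : ∃ D, D = Nat.sqrt (k * n) := ⟨_, rfl⟩
  have hD1 : D * D ≤ k * n := hD ▸ Nat.sqrt_le _
  have hD2 : k * n < (D + 1) * (D + 1) := hD ▸ Nat.lt_succ_sqrt _
  rw [← hn, ← hh] at hN
  rw [← hn] at hsk hnk
  have hk2 : 2 * k ≤ k ^ 2 := by nlinarith
  have hk4 : 4 * k ^ 2 ≤ k ^ 4 := by nlinarith [Nat.mul_le_mul hk2 hk2]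
  have hkn : 13696 * k ^ 2 ≤ n := by omega
  -- This rests on `82² = 6724 ≤ 2 · 3424`, together with `2k³ ≤ k⁴`.
  have hkD : 82 * (k * D) ≤ n := by
    by_contra! hcon
    have h1 : k ^ 3 * 2 ≤ k ^ 4 := by
      rw [pow_succ k 3]
      exact Nat.mul_le_mul_left _ hk
    have h2 : n * n < (82 * (k * D)) * (82 * (k * D)) := Nat.mul_lt_mul'' hcon hcon
    have h3 : (82 * (k * D)) * (82 * (k * D)) = 6724 * k ^ 2 * (D * D) := by ring
    have h4 : 6724 * k ^ 2 * (D * D) ≤ 6724 * k ^ 2 * (k * n) := Nat.mul_le_mul_left _ hD1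
    have h5 : 6724 * k ^ 2 * (k * n) = (6724 * k ^ 3) * n := by ring
    have h6 : (6724 * k ^ 3) * n ≤ n * n := Nat.mul_le_mul_right _ (by omega)
    omega
  have hDk : 58 * k ^ 2 ≤ D := by
    by_contra! hcon
    have h1 : (D + 1) * (D + 1) ≤ (58 * k ^ 2) * (58 * k ^ 2) := Nat.mul_le_mul hcon hcon
    have h2 : (58 * k ^ 2) * (58 * k ^ 2) = 3364 * k ^ 4 := by ring
    have h3 : n ≤ k * n := Nat.le_mul_of_pos_left _ (by omega)
    omega
  have hD2k : 2 * D ≤ k * D := Nat.mul_le_mul_right _ hk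
  have hks : 144 * (k * s) ≤ n := by
    have h1 : 2 * k * (72 * s) ≤ k ^ 2 * (72 * s) := Nat.mul_le_mul_right _ hk2
    have h2 : k ^ 2 * (72 * s) = 72 * k ^ 2 * s := by ring
    have h3 : 2 * k * (72 * s) = 144 * (k * s) := by ring
    omega
  have h2s : 2 * s ≤ k * s := Nat.mul_le_mul_right _ hk
  have hhD : 2 * (h * D) ≤ k * D := by
    rw [← mul_assoc]
    exact Nat.mul_le_mul_right _ (by omega)
  have hhs : 2 * (h * s) ≤ k * s := by
    rw [← mul_assoc]
    exact Nat.mul_le_mul_right _ (by omega)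
  have hhh : h * h ≤ k ^ 2 := by
    rw [sq]
    exact Nat.mul_le_mul (by omega) (by omega)
  have hd := exists_card_nbrs_inter_le hk hfree
  obtain ⟨W, hW3, hW⟩ := exists_three_core G
  have hWs := card_three_core_le hG hs W hW3
  have hWk : (k - 2 + 1) * #W ≤ k * s := Nat.mul_le_mul (by omega) hWs
  set T := univ.filter fun x => D < #(nbrs H x) with hTdef
  have hTc : #T ≤ 2 * D + 1 :=
    card_filter_lt_card_nbrs_le hk hfree (by omega) (by omega) hD2
  have hT : ∀ z, z ∉ T → #(nbrs H z) ≤ D := fun z hz => by simpa [hTdef] using hz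
  have hk12 : k ≤ 2 * h + 1 := by omega
  have hh1 : 1 ≤ h := by omega
  -- The threshold `6D` covers `#T + 3D ≤ 5D + 1`, the room needed for the greedy phase.
  by_cases hcase : ∃ c, 6 * D ≤ #((nbrs G c).filter fun u => #(nbrs G u) = 1)
  · obtain ⟨c, hcD⟩ := hcase
    have hU : ∀ u ∈ (nbrs G c).filter fun u => #(nbrs G u) = 1, nbrs G u = {c} := by
      intro u hu
      rw [mem_filter, mem_nbrs] at hu
      obtain ⟨b, hb⟩ := card_eq_one.1 hu.2
      have : c ∈ nbrs G u := mem_nbrs.2 hu.1.symm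
      rw [hb, mem_singleton] at this
      rw [hb, this]
    by_cases hx : ∃ x, #(nbrs H x) + 1 ≤ h
    · obtain ⟨x, hx⟩ := hx
      exact isContained_compl_of_many_leaves_at (Q := ∅) (Y := ∅) (T := T) (x := x) hd (hn ▸ hN)
        hT hW3 hW hU (by simp) (by simp) (by simp only [hTdef, mem_filter, not_and]; omega)
        (by simp) (by simp) rfl (by simpa using hx) (by rw [card_empty]; omega)
        (by rw [card_empty]; omega)
    · push Not at hx
      have hΔ := card_nbrs_le_of_forall_le_card_nbrs hk hk12 hfree fun v => by
        have := hx v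
        omega
      obtain ⟨x⟩ : Nonempty Ω := Fintype.card_pos_iff.1 (by omega)
      have hx1 := hx x
      have hx2 := hΔ x
      obtain ⟨Y, hYx, hYc⟩ := exists_subset_card_eq
        (show #(nbrs H x) - (h - 1) ≤ #(nbrs H x) by omega)
      -- Here every degree in `H` is between `h` and `k - 2`, so `#Y ≤ k - 1 - h`, whence `2 * #Y +
      -- 1 ≤ k`. The exceptional set `T` can be taken empty with `k - 2` in place of `D`.
      obtain ⟨Q, hQc, hQ, hQc'⟩ := exists_independent_nonneighbours (q := #Y) hG hs (hn ▸ hsk) hk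
        (hn ▸ hnk) (by omega) c (hc c)
      have hsd := card_sdiff_add_card_eq_card hYx
      have h1 : (1 + #Q) * (k - 2 + 1) ≤ k * k := Nat.mul_le_mul (by omega) (by omega)
      have h2 : (3 + #Q) * (k - 2) ≤ (2 * k) * k := Nat.mul_le_mul (by omega) (by omega)
      have h3 : (2 * k) * k = 2 * k ^ 2 := by ring
      rw [← sq] at h1
      exact isContained_compl_of_many_leaves_at (Q := Q) (Y := Y) (T := ∅) (x := x) (D := k - 2) hd
        (hn ▸ hN) (fun z _ => hΔ z) hW3 hW hU hQ hQc' (by simp) (by simp) hYx hQc.symm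
        (by omega) (by rw [card_empty]; omega) (by rw [card_empty]; omega)
  push Not at hcase
  by_cases hL : h * (6 * D) ≤ #(univ.filter fun u => #(nbrs G u) = 1)
  · exact isContained_compl_of_many_leaves hG (by omega) hk12 hfree hd (hn ▸ hN) hh1 hT hW3 hW
      (by omega) (by omega) (by omega) hcase hL
  · obtain ⟨U, hU, hUsep, hUc⟩ := exists_separated_interiorVerts G
    have h1 := card_le_card_interiorVerts_add hG (by omega) hs
    have h2 : h * (6 * D) = 6 * (h * D) := by ring
    have h3 : h * (7 * D + 3 + s + h) = 7 * (h * D) + 3 * h + h * s + h * h := by ring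
    -- The value of `y` is `3(2D + 1) + D + s + h`, from `#T ≤ 2D + 1` and `#W ≤ s`. Fewer than `6hD
    -- ≤ 3kD` leaves exclude at most about `48kD` vertices from the interior, which `82kD ≤ n`
    -- affords.
    exact isContained_compl_of_many_interiorVerts (y := 7 * D + 3 + s + h) hk12 hfree hd (hn ▸ hN)
      hh1 hT hW3 hW hU hUsep (by omega) (by omega) (by omega) (by omega)

end UpperBound

/-! ### The two-clique construction -/

section LowerBound

/-- The disjoint union of a complete graph on the first `m` vertices and a complete graph on the
remaining ones. -/
def twoCliques (m N : ℕ) : SimpleGraph (Fin N) where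
  Adj i j := i ≠ j ∧ (i.1 < m ↔ j.1 < m)
  symm := ⟨fun _ _ h => ⟨h.1.symm, h.2.symm⟩⟩
  loopless := ⟨fun _ h => h.1 rfl⟩

theorem card_filter_not_lt_le (m N : ℕ) : #(univ.filter fun i : Fin N => ¬ i.1 < m) ≤ N - m := by
  calc #(univ.filter fun i : Fin N => ¬ i.1 < m)
      = #((univ.filter fun i : Fin N => ¬ i.1 < m).map Fin.valEmbedding) := (card_map _).symm
    _ ≤ #(Ico m N) := card_le_card fun i hi => by
        simp only [mem_map, mem_filter, mem_univ, true_and, Fin.valEmbedding_apply] at hi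
        obtain ⟨j, hj, rfl⟩ := hi
        rw [mem_Ico]
        omega
    _ = N - m := by simp

theorem not_isContained_twoCliques {V : Type*} [Fintype V] {G : SimpleGraph V} {m N : ℕ}
    (hG : G.Connected) (hm : m < Fintype.card V) (hN : N - m < Fintype.card V) :
    ¬ G ⊑ twoCliques m N := by
  rintro ⟨f⟩
  have hside : ∀ u v, G.Reachable u v → ((f u).1 < m ↔ (f v).1 < m) := by
    rintro u v ⟨p⟩
    induction p with
    | nil => rfl
    | cons huv _ ih => exact ((f.toHom.map_adj huv).2).trans ih
  obtain ⟨v₀⟩ := hG.nonempty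
  have hcard : ∀ S : Finset (Fin N), (∀ v, f v ∈ S) → Fintype.card V ≤ #S := fun S hS => by
    rw [← card_univ, ← card_image_of_injective univ f.injective]
    exact card_le_card (image_subset_iff.2 fun v _ => hS v)
  by_cases h0 : (f v₀).1 < m
  · have h1 := hcard (univ.filter fun i => i.1 < m) fun v => by
      simpa using (hside v₀ v (hG.preconnected _ _)).1 h0
    have h2 : #(univ.filter fun i : Fin N => i.1 < m) ≤ m := by
      calc #(univ.filter fun i : Fin N => i.1 < m)
          = #((univ.filter fun i : Fin N => i.1 < m).map Fin.valEmbedding) := (card_map _).symm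
        _ ≤ #(range m) := card_le_card fun i hi => by
            simp only [mem_map, mem_filter, mem_univ, true_and, Fin.valEmbedding_apply] at hi
            obtain ⟨j, hj, rfl⟩ := hi
            exact mem_range.2 hj
        _ = m := card_range m
    omega
  · have h1 := hcard (univ.filter fun i => ¬ i.1 < m) fun v => by
      have := (hside v₀ v (hG.preconnected _ _)).not.1 h0
      simpa using this
    have h2 := card_filter_not_lt_le m N
    omega

/-- Consecutive path vertices lie on opposite sides, so each of the `k / 2` disjoint pairs `2i, 2i +
1` uses a vertex of the second side. -/
theorem not_pathGraph_isContained_compl_twoCliques {k m N : ℕ} (hN : N - m < k / 2) :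
    ¬ SimpleGraph.pathGraph k ⊑ (twoCliques m N)ᶜ := by
  rintro ⟨f⟩
  have hstep : ∀ i (hi : i + 1 < k), ((f ⟨i, by omega⟩).1 < m ↔ ¬ (f ⟨i + 1, hi⟩).1 < m) := by
    intro i hi
    have h1 := f.toHom.map_adj (show (SimpleGraph.pathGraph k).Adj ⟨i, by omega⟩ ⟨i + 1, hi⟩ by
      rw [SimpleGraph.pathGraph_adj]
      exact Or.inl rfl)
    rw [SimpleGraph.compl_adj] at h1
    have h2 : ¬ (_ ∧ _) := h1.2
    have h3 := fun h => h2 ⟨h1.1, h⟩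
    simp only [SimpleGraph.Copy.toHom_apply] at h3
    tauto
  have hex : ∀ i : Fin (k / 2), ∃ j : Fin k, j.1 / 2 = i.1 ∧ ¬ (f j).1 < m := by
    intro i
    have := hstep (2 * i.1) (by omega)
    by_cases h0 : (f ⟨2 * i.1, by omega⟩).1 < m
    · exact ⟨⟨2 * i.1 + 1, by omega⟩, by simp; omega, this.1 h0⟩
    · exact ⟨⟨2 * i.1, by omega⟩, by simp, h0⟩
  choose g hg hgm using hex
  have hinj : Function.Injective fun i => f (g i) := fun a b hab => by
    have := f.injective hab
    exact Fin.ext (by rw [← hg a, ← hg b, this])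
  have h1 := card_le_card (show univ.image (fun i => f (g i)) ⊆ univ.filter fun i => ¬ i.1 < m from
    image_subset_iff.2 fun i _ => by simpa using hgm i)
  rw [card_image_of_injective _ hinj, card_univ, Fintype.card_fin] at h1
  have h2 := card_filter_not_lt_le m N
  omega

end LowerBound

theorem card_nbrs_eq_degree {V : Type*} [Fintype V] (G : SimpleGraph V) [DecidableRel G.Adj]
    (v : V) : #(nbrs G v) = G.degree v := by
  rw [← SimpleGraph.card_neighborFinset_eq_degree]
  congr 1
  ext w
  simp

end SparsePathRamsey

theorem mainTheorem4 {V : Type*} [Fintype V] (G : SimpleGraph V) [DecidableRel G.Adj]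
    (n k : ℕ) (hn : Fintype.card V = n) (hG : G.Connected)
    (hedges : (G.edgeFinset.card : ℝ) ≤ (1 + 1 / (144 * (k : ℝ) ^ 2)) * (n : ℝ))
    (hdeg : (G.maxDegree : ℝ) < (n : ℝ) - 1 / 6 * Real.sqrt ((n : ℝ) / (k : ℝ)))
    (hk : 2 ≤ k) (hnk : 3424 * k ^ 4 ≤ n) :
    ramseyNumber G (SimpleGraph.pathGraph k) = n + k / 2 - 1 := by
  subst hn
  have hk0 : (0 : ℝ) < k := by
    exact_mod_cast (by omega : 0 < k)
  have hkn : k ≤ Fintype.card V := by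
    have := Nat.le_self_pow (by norm_num : 4 ≠ 0) k
    omega
  -- The excess `s` is a truncated difference, equal to 0 when `G` has at most `n` edges.
  have hs : ∑ v, (nbrs G v).card ≤
      2 * Fintype.card V + (2 * G.edgeFinset.card - 2 * Fintype.card V) := by
    simp only [card_nbrs_eq_degree, G.sum_degrees_eq_twice_card_edges]
    omega
  have hsk : 72 * k ^ 2 * (2 * G.edgeFinset.card - 2 * Fintype.card V) ≤ Fintype.card V := by
    rcases le_total G.edgeFinset.card (Fintype.card V) with hle | hle
    · rw [Nat.sub_eq_zero_of_le (by omega)]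
      simp
    · have h1 : (G.edgeFinset.card : ℝ) - Fintype.card V ≤
          Fintype.card V / (144 * (k : ℝ) ^ 2) := by
        rw [add_mul, one_mul, one_div_mul_eq_div] at hedges
        linarith
      rw [le_div_iff₀ (by positivity)] at h1
      rw [← Nat.cast_le (α := ℝ), ← Nat.mul_sub]
      push_cast [Nat.cast_sub hle]
      linarith
  have hc : ∀ c, Fintype.card V < 36 * k * (Fintype.card V - (nbrs G c).card) ^ 2 := by
    intro c
    have h1 : (nbrs G c).card ≤ G.maxDegree := by
      rw [card_nbrs_eq_degree]
      exact G.degree_le_maxDegree c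
    have h2 : (nbrs G c).card ≤ Fintype.card V := Finset.card_le_univ _
    have h3 : ((nbrs G c).card : ℝ) ≤ G.maxDegree := by exact_mod_cast h1
    have h4 : Real.sqrt ((Fintype.card V : ℝ) / k) <
        6 * ((Fintype.card V : ℝ) - (nbrs G c).card) := by linarith
    have h5 := (Real.sqrt_lt' (lt_of_le_of_lt (Real.sqrt_nonneg _) h4)).1 h4
    rw [div_lt_iff₀ hk0] at h5
    rw [← Nat.cast_lt (α := ℝ)]
    push_cast [Nat.cast_sub h2]
    linarith
  have hmem : Fintype.card V + k / 2 - 1 ∈ {N : ℕ | 0 < N ∧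
      ∀ F : SimpleGraph (Fin N), G ⊑ F ∨ SimpleGraph.pathGraph k ⊑ Fᶜ} := by
    refine ⟨by omega, fun F => or_iff_not_imp_right.2 fun hfree => ?_⟩
    have := isContained_compl_of_sparse_of_path_free hG hs hsk hk hnk hc
      (by rw [Fintype.card_fin]; omega) hfree
    rwa [compl_compl] at this
  refine le_antisymm (Nat.sInf_le hmem) (le_csInf ⟨_, hmem⟩ ?_)
  rintro N ⟨-, hF⟩
  by_contra! hcon
  -- Since `N ≤ n + k / 2 - 2`, a first clique on at most `n - 1` vertices leaves at most `k / 2 -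
  -- 1` for the second.
  rcases hF (twoCliques (Fintype.card V - 1) N) with h | h
  · exact not_isContained_twoCliques hG (by omega) (by omega) h
  · exact not_pathGraph_isContained_compl_twoCliques (by omega) h
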